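/- Fix an integer $b\ge 1$ (the maximal bucket size) and one of the following three families of random bucket increasing trees. A tree has nodes (buckets) containing between $1$ and $b$ labels; $c(v)$ is the number of labels in the node $v$ and $\deg^+(v)$ its number of children. The random tree of size $1$ is a single root bucket containing the label $1$. Given the random tree of size $n\ge 1$ (with labels $1,\dots,n$), the label $n+1$ is attracted by a node $v$ with probability $p(v)$; if $c(v)<b$ it is put into the bucket $v$, and if $c(v)=b$ it forms a new bucket that becomes a child of $v$. Here - bucket recursive trees: $p(v)=\frac{c(v)}{n}$, and $\kappa:=0$; - $(b,d)$-ary increasing trees ($d\ge 2$ an integer): $p(v)=\frac{(d-1)c(v)+1-\deg^+(v)}{(d-1)n+1}$, and $\kappa:=\frac1{d-1}$; - $(b,\alpha)$-plane oriented recursive trees ($\alpha>0$ real): $p(v)=\frac{\deg^+(v)+(\alpha+1)c(v)-1}{(\alpha+1)n-1}$, and $\kappa:=-\frac1{\alpha+1}$. Let $K_n$ be the number of labels in the bucket containing the label $n$ in the random tree of size $n$, and let $Y_{n,j}$ be the number of labels $\ge j$ contained in the subtree rooted at the bucket containing the label $j$, in the random tree of size $n$. As $n\to\infty$, $K_n$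 converges in distribution to a random variable $K$ with $$\mathbb P\{K=m\}=\frac{1}{(m+\kappa)\sum_{k=1}^{b}\frac1{k+\kappa}},\qquad 1\le m\le b,$$ and, for $n\to\infty$ and $j=j(n)$, the random variable $Y_{n,j}$ has the following limit laws, where a distribution with a random parameter denotes the corresponding mixture. 1. For fixed $j\ge b+1$: $\;Y_{n,j}/n\to \beta(K_j+\kappa,\,j-K_j)$ in distribution. 2. If $j\to\infty$ and $j=o(n)$: $\;jY_{n,j}/n\to\gamma(K+\kappa,1)$ in distribution (shape $K+\kappa$, rate $1$). 3. If $j\sim\rho n$ with $0<\rho<1$: $\;Y_{n,j}-1\to \mathrm{NegBin}(K+\kappa,\rho)$ in distribution, where $\mathrm{NegBin}(r,\rho)$ gives the mass $\binom{r+m-1}{m}\rho^r(1-\rho)^m$ to $m=0,1,2,\dots$. 4. If $j\to\infty$, $j\le n$ and $k:=n-j=o(n)$: $\;\mathbb P\{Y_{n,j}=1\}=1+\mathcal O\!\left(\frac kn\right)$; in particular $\mathbb P\{Y_{n,j}=1\}\to1$. -/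

import Mathlib

open Filter Topology MeasureTheory ProbabilityTheory Asymptotics

/-- The data of an unordered bucket increasing tree with labels `1, …, size`.
A node (bucket) is named by the smallest label which it contains.
`node i` is the (name of the) bucket that contains the label `i`, and `parent v` is the parent of
the node `v`. The root is the node `1`; it has no parent, which is recorded as `parent 1 = 0`. -/
structure BucketTree where
  size : ℕ
  node : ℕ → ℕ
  parent : ℕ → ℕ

namespace BucketTree

instance : MeasurableSpace BucketTree := ⊤

/-- The tree of size one: a single bucket, the root, that contains only the label `1`. -/
def single : BucketTree where
  size := 1
  node := fun i => i
  parent := fun _ => 0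

/-- The set of nodes (buckets), each named by its smallest label. -/
def nodes (T : BucketTree) : Finset ℕ :=
  (Finset.Icc 1 T.size).filter fun v => T.node v = v

/-- The capacity (current load) `c(v)`: the number of labels in the bucket `v`. -/
def cap (T : BucketTree) (v : ℕ) : ℕ :=
  ((Finset.Icc 1 T.size).filter fun i => T.node i = v).card

/-- The out-degree of `v`: the number of its children. -/
def outdeg (T : BucketTree) (v : ℕ) : ℕ :=
  (T.nodes.filter fun u => T.parent u = v).card

/-- The tree in which the node `v` has attracted the next label `size + 1`, when the maximal bucket
size is `b`: an unsaturated node takes the label into its bucket, a saturated node gets a new child,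
which is a bucket containing only the new label. -/
def insert (b : ℕ) (T : BucketTree) (v : ℕ) : BucketTree :=
  if T.cap v < b then
    { size := T.size + 1
      node := Function.update T.node (T.size + 1) v
      parent := T.parent }
  else
    { size := T.size + 1
      node := Function.update T.node (T.size + 1) (T.size + 1)
      parent := Function.update T.parent (T.size + 1) v }

/-- `T.InSubtree v u`: the node `u` lies in the subtree rooted at the node `v` (`v` included). -/
def InSubtree (T : BucketTree) (v u : ℕ) : Prop :=
  ∃ k : ℕ, T.parent^[k] u = v

open Classical in
/-- The number of descendants of the label `j`: the number of labels `≥ j` contained in the subtree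
rooted at the bucket that contains `j`. -/
noncomputable def descendants (T : BucketTree) (j : ℕ) : ℕ :=
  ((Finset.Icc j T.size).filter fun i => T.InSubtree (T.node j) (T.node i)).card

end BucketTree

/-- The three families of random bucket increasing trees: bucket recursive trees, `(b,d)`-ary
increasing trees with an integer `d ≥ 2`, and `(b,α)`-plane oriented recursive trees with a real
`α > 0`. -/
inductive BucketFamily where
  | recursive : BucketFamily
  | ary (d : ℕ) (hd : 2 ≤ d) : BucketFamily
  | port (α : ℝ) (hα : 0 < α) : BucketFamily

namespace BucketFamily

/-- The constant `κ` of the family. -/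
noncomputable def kappa : BucketFamily → ℝ
  | recursive => 0
  | ary d _ => 1 / ((d : ℝ) - 1)
  | port α _ => -1 / (α + 1)

/-- The probability `p(v)` that a node of capacity `c` and out-degree `deg` of a tree of size `n`
attracts the next label. -/
noncomputable def attractProb : BucketFamily → (n c deg : ℕ) → ℝ
  | recursive, n, c, _ => (c : ℝ) / n
  | ary d _, n, c, deg => (((d : ℝ) - 1) * c + 1 - deg) / (((d : ℝ) - 1) * n + 1)
  | port α _, n, c, deg => (deg + (α + 1) * c - 1) / ((α + 1) * n - 1)

/-- One step of the growth process: the law of the tree obtained from `T` by inserting one label. -/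
noncomputable def growthStep (F : BucketFamily) (b : ℕ) (T : BucketTree) : Measure BucketTree :=
  ∑ v ∈ T.nodes,
    ENNReal.ofReal (F.attractProb T.size (T.cap v) (T.outdeg v)) • Measure.dirac (T.insert b v)

/-- The law of the tree after `k` insertions into the tree of size one. -/
noncomputable def growth (F : BucketFamily) (b : ℕ) : ℕ → Measure BucketTree
  | 0 => Measure.dirac BucketTree.single
  | k + 1 => (growth F b k).bind (F.growthStep b)

/-- The law of the random tree of size `n ≥ 1` of the family, with maximal bucket size `b`. -/
noncomputable def treeLaw (F : BucketFamily) (b n : ℕ) : Measure BucketTree :=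
  F.growth b (n - 1)

/-- The law of `K_j`, the size of the bucket that contains the label `j` in the random tree of
size `j`. -/
noncomputable def initialSizeLaw (F : BucketFamily) (b j : ℕ) : Measure ℕ :=
  (F.treeLaw b j).map fun T => T.cap (T.node j)

/-- The weights `P(K = m) = 1 / ((m + κ) (H_{b+κ} - H_κ))`, `1 ≤ m ≤ b`, where
`H_{b+κ} - H_κ = ∑_{k=1}^b 1 / (k + κ)`. -/
noncomputable def limitSizeWeight (F : BucketFamily) (b m : ℕ) : ℝ :=
  1 / ((m + F.kappa) * ∑ k ∈ Finset.Icc 1 b, 1 / ((k : ℝ) + F.kappa))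

/-- The law of `K`, the limit of the initial bucket sizes `K_j` as `j → ∞`. -/
noncomputable def limitSizeLaw (F : BucketFamily) (b : ℕ) : Measure ℕ :=
  ∑ m ∈ Finset.Icc 1 b, ENNReal.ofReal (F.limitSizeWeight b m) • Measure.dirac m

end BucketFamily

/-- The negative binomial distribution `NegBin(r, ρ)` with real parameter `r > 0` and success
probability `ρ`, as a measure on `ℝ`: the point `m = 0, 1, 2, …` has the mass
`(r+m-1 choose m) ρ^r (1-ρ)^m`. -/
noncomputable def negBinMeasure (r ρ : ℝ) : Measure ℝ :=
  Measure.sum fun m : ℕ =>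
    ENNReal.ofReal (Ring.choose (r + m - 1) m * ρ ^ r * (1 - ρ) ^ m) • Measure.dirac (m : ℝ)

lemma isProbabilityMeasure_negBinMeasure {r ρ : ℝ} (hr : 0 < r) (h0 : 0 < ρ) (h1 : ρ < 1) :
    IsProbabilityMeasure (negBinMeasure r ρ) := by
  have hpos : ∀ m : ℕ, 0 ≤ Ring.choose (r + m - 1) m := by
    intro m
    rw [← Ring.multichoose_eq]
    have h := Ring.factorial_nsmul_multichoose_eq_ascPochhammer r m
    rw [Polynomial.ascPochhammer_smeval_eq_eval, nsmul_eq_mul] at h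
    have h2 := ascPochhammer_pos m r hr
    rw [← h] at h2
    exact (pos_of_mul_pos_right h2 (by positivity)).le
  have hs : HasSum (fun m : ℕ => Ring.choose (r + m - 1) m * ρ ^ r * (1 - ρ) ^ m) 1 := by
    have h := (Real.one_div_one_sub_rpow_hasFPowerSeriesOnBall_zero r).hasSum
      (y := 1 - ρ) (by
        rw [Metric.mem_eball, edist_dist]
        simp only [dist_zero_right, Real.norm_eq_abs]
        rw [abs_of_pos (by linarith), ← ENNReal.ofReal_one]
        exact (ENNReal.ofReal_lt_ofReal_iff one_pos).2 (by linarith))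
    have h' := h.mul_left (ρ ^ r)
    simp only [zero_add, sub_sub_cancel] at h'
    rw [mul_one_div_cancel (Real.rpow_pos_of_pos h0 r).ne'] at h'
    refine h'.congr_fun ?_
    intro m
    simp [FormalMultilinearSeries.ofScalars, mul_comm, mul_left_comm]
  exact hs.isProbabilityMeasure_sum_dirac
    (fun m => mul_nonneg (mul_nonneg (hpos m) (by positivity)) (pow_nonneg (by linarith) m))

namespace BucketFamily

lemma neg_one_lt_kappa (F : BucketFamily) : -1 < F.kappa := by
  cases F with
  | recursive => simp [kappa]
  | ary d hd =>
    have : (2 : ℝ) ≤ d := by exact_mod_cast hd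
    have : 0 < 1 / ((d : ℝ) - 1) := by apply one_div_pos.2; linarith
    simp only [kappa]; linarith
  | port α hα =>
    simp only [kappa]
    rw [lt_div_iff₀ (by linarith)]; linarith

lemma add_kappa_pos (F : BucketFamily) {m : ℕ} (hm : 1 ≤ m) : 0 < (m : ℝ) + F.kappa := by
  have := F.neg_one_lt_kappa
  have : (1 : ℝ) ≤ m := by exact_mod_cast hm
  linarith

lemma isProbabilityMeasure_limitSizeLaw (F : BucketFamily) {b : ℕ} (hb : 1 ≤ b) :
    IsProbabilityMeasure (F.limitSizeLaw b) := by
  have hS : 0 < ∑ k ∈ Finset.Icc 1 b, 1 / ((k : ℝ) + F.kappa) :=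
    Finset.sum_pos (fun k hk => one_div_pos.2 (F.add_kappa_pos (Finset.mem_Icc.1 hk).1))
      ⟨1, Finset.mem_Icc.2 ⟨le_rfl, hb⟩⟩
  constructor
  simp only [limitSizeLaw, Measure.coe_finsetSum, Finset.sum_apply, Measure.smul_apply,
    measure_univ, smul_eq_mul, mul_one]
  rw [← ENNReal.ofReal_sum_of_nonneg, ← ENNReal.ofReal_one]
  · congr 1
    simp only [limitSizeWeight, ← div_div]
    rw [← Finset.sum_div, div_self hS.ne']
  · intro m hm
    have := F.add_kappa_pos (Finset.mem_Icc.1 hm).1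
    unfold limitSizeWeight
    positivity

lemma ae_limitSizeLaw (F : BucketFamily) (b : ℕ) :
    ∀ᵐ m ∂(F.limitSizeLaw b), 1 ≤ m ∧ m ≤ b := by
  rw [ae_iff]
  simp only [limitSizeLaw, Measure.coe_finsetSum, Finset.sum_apply, Measure.smul_apply]
  refine Finset.sum_eq_zero fun m hm => ?_
  rw [Measure.dirac_apply' _ (by measurability), Set.indicator_of_notMem]
  · simp
  · simpa using Finset.mem_Icc.1 hm

end BucketFamily

/-- The invariants of the growth process: what makes `T` a bucket increasing tree with buckets of
size at most `max b 1`, on which the attraction probabilities are nonnegative. -/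
structure BucketTree.Valid (F : BucketFamily) (b : ℕ) (T : BucketTree) : Prop where
  size_pos : 1 ≤ T.size
  node_mem : ∀ i ∈ Finset.Icc 1 T.size, T.node i ∈ T.nodes
  root_node : T.node 1 = 1
  root_parent : T.parent 1 = 0
  parent_mem : ∀ v ∈ T.nodes, v ≠ 1 → T.parent v ∈ T.nodes
  cap_le : ∀ v, T.cap v ≤ max b 1
  prob_nonneg : ∀ v ∈ T.nodes, 0 ≤ F.attractProb T.size (T.cap v) (T.outdeg v)

namespace BucketFamily

lemma attractProb_nonneg_mono (F : BucketFamily) {n n' c c' deg : ℕ} (hn : 1 ≤ n) (hn' : 1 ≤ n')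
    (hc : c ≤ c') (h : 0 ≤ F.attractProb n c deg) : 0 ≤ F.attractProb n' c' deg := by
  have hn1 : (1 : ℝ) ≤ n := by exact_mod_cast hn
  have hn1' : (1 : ℝ) ≤ n' := by exact_mod_cast hn'
  have hcc : (c : ℝ) ≤ c' := by exact_mod_cast hc
  cases F with
  | recursive => simp only [attractProb]; positivity
  | ary d hd =>
    have hd' : (2 : ℝ) ≤ d := by exact_mod_cast hd
    simp only [attractProb] at h ⊢
    have hden : 0 < ((d : ℝ) - 1) * n + 1 := by nlinarith
    have hden' : 0 < ((d : ℝ) - 1) * n' + 1 := by nlinarith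
    have h1 : 0 ≤ ((d : ℝ) - 1) * c + 1 - deg := by
      by_contra hneg
      exact absurd h (not_le.2 (div_neg_of_neg_of_pos (not_le.1 hneg) hden))
    refine div_nonneg ?_ hden'.le
    nlinarith
  | port α hα =>
    simp only [attractProb] at h ⊢
    have hden : 0 < (α + 1) * n - 1 := by nlinarith
    have hden' : 0 < (α + 1) * n' - 1 := by nlinarith
    have h1 : 0 ≤ deg + (α + 1) * c - 1 := by
      by_contra hneg
      exact absurd h (not_le.2 (div_neg_of_neg_of_pos (not_le.1 hneg) hden))
    refine div_nonneg ?_ hden'.le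
    nlinarith

lemma attractProb_nonneg_succ (F : BucketFamily) {n n' c deg : ℕ} (hn : 1 ≤ n) (hn' : 1 ≤ n')
    (hc : 1 ≤ c) (h : 0 < F.attractProb n c deg) : 0 ≤ F.attractProb n' c (deg + 1) := by
  have hn1 : (1 : ℝ) ≤ n := by exact_mod_cast hn
  have hn1' : (1 : ℝ) ≤ n' := by exact_mod_cast hn'
  have hcc : (1 : ℝ) ≤ c := by exact_mod_cast hc
  cases F with
  | recursive => simp only [attractProb]; positivity
  | ary d hd =>
    have hd' : (2 : ℝ) ≤ d := by exact_mod_cast hd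
    simp only [attractProb] at h ⊢
    have hden : 0 < ((d : ℝ) - 1) * n + 1 := by nlinarith
    have hden' : 0 < ((d : ℝ) - 1) * n' + 1 := by nlinarith
    have h1 : 0 < ((d : ℝ) - 1) * c + 1 - deg := by
      by_contra hneg
      exact absurd h (not_lt.2 (div_nonpos_of_nonpos_of_nonneg (not_lt.1 hneg) hden.le))
    have h2 : (0 : ℤ) < ((d : ℤ) - 1) * c + 1 - deg := by exact_mod_cast h1
    have h3 : (0 : ℤ) ≤ ((d : ℤ) - 1) * c + 1 - ((deg + 1 : ℕ) : ℤ) := by push_cast; omega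
    refine div_nonneg ?_ hden'.le
    exact_mod_cast h3
  | port α hα =>
    simp only [attractProb]
    have hden' : 0 < (α + 1) * n' - 1 := by nlinarith
    refine div_nonneg ?_ hden'.le
    have : (0 : ℝ) ≤ ((deg + 1 : ℕ) : ℝ) := by positivity
    nlinarith

lemma attractProb_one_zero_nonneg (F : BucketFamily) {n : ℕ} (hn : 1 ≤ n) :
    0 ≤ F.attractProb n 1 0 := by
  have hn1 : (1 : ℝ) ≤ n := by exact_mod_cast hn
  cases F with
  | recursive => simp only [attractProb]; positivity
  | ary d hd =>
    have hd' : (2 : ℝ) ≤ d := by exact_mod_cast hd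
    simp only [attractProb]
    refine div_nonneg ?_ ?_ <;> push_cast <;> nlinarith
  | port α hα =>
    simp only [attractProb]
    refine div_nonneg ?_ ?_ <;> push_cast <;> nlinarith

end BucketFamily

namespace BucketTree

lemma mem_nodes {T : BucketTree} {v : ℕ} :
    v ∈ T.nodes ↔ (1 ≤ v ∧ v ≤ T.size) ∧ T.node v = v := by
  simp [nodes, Finset.mem_filter, Finset.mem_Icc]

lemma valid_single (F : BucketFamily) (b : ℕ) : single.Valid F b := by
  have hn : single.nodes = {1} := by decide
  have hc : single.cap 1 = 1 := by decide
  have hd : single.outdeg 1 = 0 := by decide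
  refine ⟨le_rfl, ?_, rfl, rfl, ?_, ?_, ?_⟩
  · intro i hi
    rw [mem_nodes]
    exact ⟨Finset.mem_Icc.1 hi, rfl⟩
  · intro v hv hv1
    rw [hn, Finset.mem_singleton] at hv
    exact absurd hv hv1
  · intro v
    refine le_trans ?_ (le_max_right b 1)
    exact (Finset.card_filter_le _ _).trans (by simp [single])
  · intro v hv
    rw [hn, Finset.mem_singleton] at hv
    subst hv
    rw [hc, hd]
    exact F.attractProb_one_zero_nonneg le_rfl

lemma cap_pos {T : BucketTree} {v : ℕ} (hv : v ∈ T.nodes) : 1 ≤ T.cap v := by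
  have := mem_nodes.1 hv
  exact Finset.card_pos.2 ⟨v, Finset.mem_filter.2 ⟨Finset.mem_Icc.2 this.1, this.2⟩⟩

lemma size_insert (b : ℕ) (T : BucketTree) (v : ℕ) : (T.insert b v).size = T.size + 1 := by
  unfold insert; split_ifs <;> rfl

lemma Icc_succ_size (T : BucketTree) :
    Finset.Icc 1 (T.size + 1) = Insert.insert (T.size + 1) (Finset.Icc 1 T.size) := by
  ext i; simp only [Finset.mem_Icc, Finset.mem_insert]; omega

lemma Valid.insert {F : BucketFamily} {b : ℕ} {T : BucketTree} (h : T.Valid F b) {v : ℕ}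
    (hv : v ∈ T.nodes) (hp : 0 < F.attractProb T.size (T.cap v) (T.outdeg v)) :
    (T.insert b v).Valid F b := by
  have hv' := mem_nodes.1 hv
  have hs := h.size_pos
  by_cases hlt : T.cap v < b
  · have e : T.insert b v = ⟨T.size + 1, Function.update T.node (T.size + 1) v, T.parent⟩ := by
      simp [BucketTree.insert, hlt]
    have hnode : ∀ i, i ≤ T.size → (T.insert b v).node i = T.node i := by
      intro i hi; rw [e]; exact Function.update_of_ne (by omega) _ _
    have hnodeN : (T.insert b v).node (T.size + 1) = v := by
      rw [e]; exact Function.update_self _ _ _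
    have hsize := size_insert b T v
    have hnodes : (T.insert b v).nodes = T.nodes := by
      ext u
      rw [mem_nodes, mem_nodes, hsize]
      constructor
      · rintro ⟨⟨h1, h2⟩, h3⟩
        rcases Nat.lt_or_ge T.size u with hu | hu
        · obtain rfl : u = T.size + 1 := by omega
          rw [hnodeN] at h3; omega
        · rw [hnode u hu] at h3; exact ⟨⟨h1, hu⟩, h3⟩
      · rintro ⟨⟨h1, h2⟩, h3⟩
        exact ⟨⟨h1, by omega⟩, by rw [hnode u h2]; exact h3⟩
    have hfilt : ∀ u, (Finset.Icc 1 T.size).filter (fun i => (T.insert b v).node i = u)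
        = (Finset.Icc 1 T.size).filter (fun i => T.node i = u) := by
      intro u
      refine Finset.filter_congr fun i hi => ?_
      rw [hnode i (Finset.mem_Icc.1 hi).2]
    have hcapv : (T.insert b v).cap v = T.cap v + 1 := by
      unfold cap
      rw [hsize, Icc_succ_size, Finset.filter_insert, if_pos hnodeN, hfilt,
        Finset.card_insert_of_notMem (by simp)]
    have hcap : ∀ u, u ≠ v → (T.insert b v).cap u = T.cap u := by
      intro u hu
      unfold cap
      rw [hsize, Icc_succ_size, Finset.filter_insert, if_neg (by rw [hnodeN]; exact hu.symm), hfilt]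
    have hout : ∀ u, (T.insert b v).outdeg u = T.outdeg u := by
      intro u; unfold outdeg; rw [hnodes, e]
    refine ⟨by omega, ?_, ?_, ?_, ?_, ?_, ?_⟩
    · intro i hi
      rw [hnodes]
      rw [hsize, Finset.mem_Icc] at hi
      rcases Nat.lt_or_ge T.size i with hu | hu
      · obtain rfl : i = T.size + 1 := by omega
        rw [hnodeN]; exact hv
      · rw [hnode i hu]; exact h.node_mem i (Finset.mem_Icc.2 ⟨hi.1, hu⟩)
    · rw [hnode 1 hs]; exact h.root_node
    · rw [e]; exact h.root_parent
    · intro u hu hu1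
      rw [hnodes] at hu ⊢
      have := h.parent_mem u hu hu1
      rw [e]; exact this
    · intro u
      by_cases hu : u = v
      · subst hu; rw [hcapv]; exact le_trans hlt (le_max_left _ _)
      · rw [hcap u hu]; exact h.cap_le u
    · intro u hu
      rw [hnodes] at hu
      rw [hout]
      refine F.attractProb_nonneg_mono hs (by omega) ?_ (h.prob_nonneg u hu)
      by_cases huv : u = v
      · subst huv; rw [hcapv]; omega
      · rw [hcap u huv]
  · have e : T.insert b v = ⟨T.size + 1, Function.update T.node (T.size + 1) (T.size + 1),
        Function.update T.parent (T.size + 1) v⟩ := by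
      simp [BucketTree.insert, hlt]
    have hnode : ∀ i, i ≤ T.size → (T.insert b v).node i = T.node i := by
      intro i hi; rw [e]; exact Function.update_of_ne (by omega) _ _
    have hnodeN : (T.insert b v).node (T.size + 1) = T.size + 1 := by
      rw [e]; exact Function.update_self _ _ _
    have hpar : ∀ i, i ≤ T.size → (T.insert b v).parent i = T.parent i := by
      intro i hi; rw [e]; exact Function.update_of_ne (by omega) _ _
    have hparN : (T.insert b v).parent (T.size + 1) = v := by
      rw [e]; exact Function.update_self _ _ _
    have hsize := size_insert b T v
    have hnodes : (T.insert b v).nodes = Insert.insert (T.size + 1) T.nodes := by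
      ext u
      rw [Finset.mem_insert, mem_nodes, mem_nodes, hsize]
      constructor
      · rintro ⟨⟨h1, h2⟩, h3⟩
        rcases Nat.lt_or_ge T.size u with hu | hu
        · left; omega
        · right; rw [hnode u hu] at h3; exact ⟨⟨h1, hu⟩, h3⟩
      · rintro (rfl | ⟨⟨h1, h2⟩, h3⟩)
        · exact ⟨⟨by omega, le_rfl⟩, hnodeN⟩
        · exact ⟨⟨h1, by omega⟩, by rw [hnode u h2]; exact h3⟩
    have hNnot : T.size + 1 ∉ T.nodes := by
      intro hN; have := mem_nodes.1 hN; omega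
    have hfilt : ∀ u, (Finset.Icc 1 T.size).filter (fun i => (T.insert b v).node i = u)
        = (Finset.Icc 1 T.size).filter (fun i => T.node i = u) := by
      intro u
      refine Finset.filter_congr fun i hi => ?_
      rw [hnode i (Finset.mem_Icc.1 hi).2]
    have hcapN0 : T.cap (T.size + 1) = 0 := by
      unfold cap
      rw [Finset.card_eq_zero, Finset.filter_eq_empty_iff]
      intro i hi h0
      have := mem_nodes.1 (h.node_mem i hi); omega
    have hcapN : (T.insert b v).cap (T.size + 1) = 1 := by
      have h0 := hcapN0
      unfold cap at h0 ⊢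
      rw [hsize, Icc_succ_size, Finset.filter_insert, if_pos hnodeN, hfilt,
        Finset.card_insert_of_notMem (by simp), h0]
    have hcap : ∀ u, u ≠ T.size + 1 → (T.insert b v).cap u = T.cap u := by
      intro u hu
      unfold cap
      rw [hsize, Icc_succ_size, Finset.filter_insert, if_neg (by rw [hnodeN]; exact hu.symm), hfilt]
    have hpfilt : ∀ u, T.nodes.filter (fun i => (T.insert b v).parent i = u)
        = T.nodes.filter (fun i => T.parent i = u) := by
      intro u
      refine Finset.filter_congr fun i hi => ?_
      rw [hpar i (mem_nodes.1 hi).1.2]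
    have houtv : (T.insert b v).outdeg v = T.outdeg v + 1 := by
      unfold outdeg
      rw [hnodes, Finset.filter_insert, if_pos hparN, hpfilt,
        Finset.card_insert_of_notMem (by simp [hNnot])]
    have hout : ∀ u, u ≠ v → (T.insert b v).outdeg u = T.outdeg u := by
      intro u hu
      unfold outdeg
      rw [hnodes, Finset.filter_insert, if_neg (by rw [hparN]; exact hu.symm), hpfilt]
    have houtN0 : T.outdeg (T.size + 1) = 0 := by
      unfold outdeg
      rw [Finset.card_eq_zero, Finset.filter_eq_empty_iff]
      intro i hi h0
      by_cases h1 : i = 1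
      · subst h1; rw [h.root_parent] at h0; omega
      · have := mem_nodes.1 (h.parent_mem i hi h1); omega
    refine ⟨by omega, ?_, ?_, ?_, ?_, ?_, ?_⟩
    · intro i hi
      rw [hnodes, Finset.mem_insert]
      rw [hsize, Finset.mem_Icc] at hi
      rcases Nat.lt_or_ge T.size i with hu | hu
      · obtain rfl : i = T.size + 1 := by omega
        left; exact hnodeN
      · right; rw [hnode i hu]; exact h.node_mem i (Finset.mem_Icc.2 ⟨hi.1, hu⟩)
    · rw [hnode 1 hs]; exact h.root_node
    · rw [hpar 1 hs]; exact h.root_parent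
    · intro u hu hu1
      rw [hnodes, Finset.mem_insert] at hu ⊢
      right
      rcases hu with rfl | hu
      · rw [hparN]; exact hv
      · rw [hpar u (mem_nodes.1 hu).1.2]; exact h.parent_mem u hu hu1
    · intro u
      by_cases hu : u = T.size + 1
      · subst hu; rw [hcapN]; exact le_max_right _ _
      · rw [hcap u hu]; exact h.cap_le u
    · intro u hu
      rw [hnodes, Finset.mem_insert] at hu
      rw [hsize]
      rcases hu with rfl | hu
      · rw [hcapN, hout _ (by omega), houtN0]
        exact F.attractProb_one_zero_nonneg (by omega)
      · have hle := (mem_nodes.1 hu).1.2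
        rw [hcap u (by omega)]
        by_cases huv : u = v
        · subst huv
          rw [houtv]
          exact F.attractProb_nonneg_succ hs (by omega) (cap_pos hv) hp
        · rw [hout u huv]
          exact F.attractProb_nonneg_mono hs (by omega) le_rfl (h.prob_nonneg u hu)

lemma Valid.sum_cap {F : BucketFamily} {b : ℕ} {T : BucketTree} (h : T.Valid F b) :
    ∑ v ∈ T.nodes, T.cap v = T.size := by
  have := Finset.card_eq_sum_card_fiberwise (f := T.node) (s := Finset.Icc 1 T.size)
    (t := T.nodes) (fun i hi => h.node_mem i hi)
  simpa [cap] using this.symm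

lemma Valid.sum_outdeg {F : BucketFamily} {b : ℕ} {T : BucketTree} (h : T.Valid F b) :
    ∑ v ∈ T.nodes, T.outdeg v + 1 = T.nodes.card := by
  have h1 : 1 ∈ T.nodes := mem_nodes.2 ⟨⟨le_rfl, h.size_pos⟩, h.root_node⟩
  have := Finset.card_eq_sum_card_fiberwise (f := T.parent) (s := T.nodes.erase 1)
    (t := T.nodes) (fun i hi => by
      have hi' := Finset.mem_erase.1 hi
      exact h.parent_mem i hi'.2 hi'.1)
  rw [← Finset.card_erase_add_one h1, this]
  congr 1
  refine Finset.sum_congr rfl fun v hv => ?_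
  unfold outdeg
  congr 1
  ext u
  simp only [Finset.mem_filter, Finset.mem_erase]
  constructor
  · rintro ⟨hu, hp⟩
    refine ⟨⟨?_, hu⟩, hp⟩
    rintro rfl
    rw [h.root_parent] at hp
    have := mem_nodes.1 hv; omega
  · rintro ⟨⟨_, hu⟩, hp⟩; exact ⟨hu, hp⟩

lemma Valid.sum_attractProb {F : BucketFamily} {b : ℕ} {T : BucketTree} (h : T.Valid F b) :
    ∑ v ∈ T.nodes, F.attractProb T.size (T.cap v) (T.outdeg v) = 1 := by
  have hn1 : (1 : ℝ) ≤ T.size := by exact_mod_cast h.size_pos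
  have hc : ∑ v ∈ T.nodes, (T.cap v : ℝ) = T.size := by exact_mod_cast h.sum_cap
  have ho : ∑ v ∈ T.nodes, (T.outdeg v : ℝ) + 1 = T.nodes.card := by exact_mod_cast h.sum_outdeg
  cases F with
  | recursive =>
    simp only [BucketFamily.attractProb]
    rw [← Finset.sum_div, hc, div_self (by linarith)]
  | ary d hd =>
    have hd' : (2 : ℝ) ≤ d := by exact_mod_cast hd
    simp only [BucketFamily.attractProb]
    rw [← Finset.sum_div, Finset.sum_sub_distrib, Finset.sum_add_distrib, ← Finset.mul_sum, hc,
      div_eq_one_iff_eq (by nlinarith)]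
    simp only [Finset.sum_const, nsmul_eq_mul, mul_one]
    linarith
  | port α hα =>
    simp only [BucketFamily.attractProb]
    rw [← Finset.sum_div, Finset.sum_sub_distrib, Finset.sum_add_distrib, ← Finset.mul_sum, hc,
      div_eq_one_iff_eq (by nlinarith)]
    simp only [Finset.sum_const, nsmul_eq_mul, mul_one]
    linarith

end BucketTree

namespace BucketFamily

lemma aemeasurable_of_bucketTree {β : Type*} [MeasurableSpace β] (f : BucketTree → β)
    (μ : Measure BucketTree) : AEMeasurable f μ :=
  (show Measurable f from fun _ _ => trivial).aemeasurable

lemma measurableSet_bucketTree (s : Set BucketTree) : MeasurableSet s := trivial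

lemma isProbabilityMeasure_growthStep (F : BucketFamily) {b : ℕ} {T : BucketTree}
    (h : T.Valid F b) : IsProbabilityMeasure (F.growthStep b T) := by
  constructor
  simp only [growthStep, Measure.coe_finsetSum, Finset.sum_apply, Measure.smul_apply,
    measure_univ, smul_eq_mul, mul_one]
  rw [← ENNReal.ofReal_sum_of_nonneg h.prob_nonneg, h.sum_attractProb, ENNReal.ofReal_one]

lemma ae_growthStep (F : BucketFamily) {b : ℕ} {T : BucketTree} (h : T.Valid F b) :
    ∀ᵐ T' ∂(F.growthStep b T), T'.Valid F b ∧ T'.size = T.size + 1 := by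
  rw [ae_iff]
  simp only [growthStep, Measure.coe_finsetSum, Finset.sum_apply, Measure.smul_apply, smul_eq_mul]
  refine Finset.sum_eq_zero fun v hv => ?_
  rcases (h.prob_nonneg v hv).eq_or_lt with h0 | h0
  · rw [← h0]; simp
  · rw [Measure.dirac_apply' _ (measurableSet_bucketTree _), Set.indicator_of_notMem]
    · simp
    · simpa using ⟨h.insert hv h0, T.size_insert b v⟩

lemma growth_spec (F : BucketFamily) (b k : ℕ) :
    IsProbabilityMeasure (F.growth b k) ∧
      ∀ᵐ T ∂(F.growth b k), T.Valid F b ∧ T.size = k + 1 := by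
  induction k with
  | zero =>
    refine ⟨by unfold growth; infer_instance, ?_⟩
    rw [ae_iff]
    simp only [growth]
    rw [Measure.dirac_apply' _ (measurableSet_bucketTree _), Set.indicator_of_notMem]
    simpa using ⟨BucketTree.valid_single F b, rfl⟩
  | succ k ih =>
    obtain ⟨ih1, ih2⟩ := ih
    refine ⟨?_, ?_⟩
    · simp only [growth]
      exact isProbabilityMeasure_bind (aemeasurable_of_bucketTree _ _)
        (ih2.mono fun T hT => F.isProbabilityMeasure_growthStep hT.1)
    · rw [ae_iff]
      simp only [growth]
      rw [Measure.bind_apply (measurableSet_bucketTree _) (aemeasurable_of_bucketTree _ _),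
        lintegral_eq_zero_iff' (aemeasurable_of_bucketTree _ _)]
      refine ih2.mono fun T hT => ?_
      have := F.ae_growthStep hT.1
      rw [hT.2, ae_iff] at this
      exact this

instance (F : BucketFamily) (b n : ℕ) : IsProbabilityMeasure (F.treeLaw b n) :=
  (F.growth_spec b (n - 1)).1

instance (F : BucketFamily) (b j : ℕ) : IsProbabilityMeasure (F.initialSizeLaw b j) :=
  Measure.isProbabilityMeasure_map (aemeasurable_of_bucketTree _ _)

lemma ae_initialSizeLaw (F : BucketFamily) {b j : ℕ} (hb : 1 ≤ b) (hj : 1 ≤ j) :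
    ∀ᵐ m ∂(F.initialSizeLaw b j), 1 ≤ m ∧ m ≤ b := by
  unfold initialSizeLaw
  rw [ae_map_iff (aemeasurable_of_bucketTree _ _) (by measurability)]
  refine (F.growth_spec b (j - 1)).2.mono fun T hT => ⟨?_, ?_⟩
  · exact BucketTree.cap_pos (hT.1.node_mem j (Finset.mem_Icc.2 ⟨hj, by omega⟩))
  · have := hT.1.cap_le (T.node j)
    rwa [max_eq_left hb] at this

/-- The law `β(K_j + κ, j - K_j)`: the beta distribution with the random parameter `K_j`, that is,
the mixture of the laws `β(ℓ + κ, j - ℓ)` with the weights `P(K_j = ℓ)`. -/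
noncomputable def betaLimit (F : BucketFamily) (b j : ℕ) (hb : 1 ≤ b) (hj : b + 1 ≤ j) :
    ProbabilityMeasure ℝ :=
  ⟨(F.initialSizeLaw b j).bind fun l => betaMeasure (l + F.kappa) (j - l),
    isProbabilityMeasure_bind Measurable.of_discrete.aemeasurable
      ((F.ae_initialSizeLaw hb (by omega)).mono fun l hl =>
        isProbabilityMeasureBeta (F.add_kappa_pos hl.1) (by
          have : (l : ℝ) < j := by exact_mod_cast (by omega : l < j)
          linarith))⟩

/-- The law `γ(K + κ, 1)`: the gamma distribution with shape `K + κ` and rate `1`, mixed over the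
law of `K`. -/
noncomputable def gammaLimit (F : BucketFamily) (b : ℕ) (hb : 1 ≤ b) : ProbabilityMeasure ℝ :=
  ⟨(F.limitSizeLaw b).bind fun l => gammaMeasure (l + F.kappa) 1,
    haveI := F.isProbabilityMeasure_limitSizeLaw hb
    isProbabilityMeasure_bind Measurable.of_discrete.aemeasurable
      ((F.ae_limitSizeLaw b).mono fun _ hl =>
        isProbabilityMeasure_gammaMeasure (F.add_kappa_pos hl.1) one_pos)⟩

/-- The law `NegBin(K + κ, ρ)`, mixed over the law of `K`. -/
noncomputable def negBinLimit (F : BucketFamily) (b : ℕ) (hb : 1 ≤ b) (ρ : ℝ) (h0 : 0 < ρ)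
    (h1 : ρ < 1) : ProbabilityMeasure ℝ :=
  ⟨(F.limitSizeLaw b).bind fun l => negBinMeasure (l + F.kappa) ρ,
    haveI := F.isProbabilityMeasure_limitSizeLaw hb
    isProbabilityMeasure_bind Measurable.of_discrete.aemeasurable
      ((F.ae_limitSizeLaw b).mono fun _ hl =>
        isProbabilityMeasure_negBinMeasure (F.add_kappa_pos hl.1) h0 h1)⟩

/-- The law of `K`, as a probability measure. -/
noncomputable def limitSize (F : BucketFamily) (b : ℕ) (hb : 1 ≤ b) : ProbabilityMeasure ℕ :=
  ⟨F.limitSizeLaw b, F.isProbabilityMeasure_limitSizeLaw hb⟩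

end BucketFamily

/-! In terms of κ, all three growth rules read p(v) = (c(v) + κ(1 − deg⁺(v)))/(n + κ)
(`attractProb_eq`). Summed over the subtree below the bucket of j, nodes contribute κ each and edges
−κ each, so a single κ survives: the subtree attracts the next label with probability (K_j + Y − 1 +
κ)/(n + κ), where Y is the current number of descendants (`sum_attractProb_subtree`). Hence, given
K_j = l, the variable Y_{n,j} − 1 counts the successes in n − j draws from a Pólya urn with initial
weights l + κ and j − l, and its law is exactly beta-binomial (`treeLaw_initialSize_descendants`).

For K_n, an unsaturated bucket has no children, so its attraction probability depends on its
capacity alone. Eliminating the mean number of buckets of capacity m gives a linear recursion for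
P(K_n = m+1) in terms of P(K_n = m) and P(K_n = m+1) (`initialSizeProb_recurrence`); conservation of
total mass supplies the missing equation for size 1. The quantities (m+κ) P(K_n = m) then perform an
averaging along a cycle with steps of order 1/n. Since the harmonic series diverges, they all tend
to one common value, which is fixed by the total mass 1 (`tendsto_of_cyclic_averaging`).

The weak limits follow from the explicit weights. Gamma function asymptotics give pointwise lower
bounds for the (rescaled) densities, and the portmanteau theorem for open sets together with Fatou's
lemma turns such bounds into convergence in distribution
(`tendsto_probabilityMeasure_of_le_liminf_density`). When n − j = o(n), a Bernoulli-type bound on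
the probability of drawing no success is enough. -/

namespace BucketTree

/-! ### Effect of one insertion on buckets and capacities -/

lemma insert_node_of_le (b : ℕ) (T : BucketTree) (v : ℕ) {i : ℕ} (hi : i ≤ T.size) :
    (T.insert b v).node i = T.node i := by
  unfold insert; split_ifs <;> exact Function.update_of_ne (by omega) _ _

lemma insert_parent_of_le (b : ℕ) (T : BucketTree) (v : ℕ) {i : ℕ} (hi : i ≤ T.size) :
    (T.insert b v).parent i = T.parent i := by
  unfold insert; split_ifs
  · rfl
  · exact Function.update_of_ne (by omega) _ _

lemma insert_node_last_of_lt {b : ℕ} {T : BucketTree} {v : ℕ} (h : T.cap v < b) :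
    (T.insert b v).node (T.size + 1) = v := by
  simp [insert, h]

lemma insert_node_last_of_le {b : ℕ} {T : BucketTree} {v : ℕ} (h : b ≤ T.cap v) :
    (T.insert b v).node (T.size + 1) = T.size + 1 := by
  simp [insert, h.not_gt]

lemma insert_parent_last_of_le {b : ℕ} {T : BucketTree} {v : ℕ} (h : b ≤ T.cap v) :
    (T.insert b v).parent (T.size + 1) = v := by
  simp [insert, h.not_gt]

lemma nodes_insert_of_lt {b : ℕ} {T : BucketTree} {v : ℕ} (hv : v ∈ T.nodes) (h : T.cap v < b) :
    (T.insert b v).nodes = T.nodes := by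
  have hv' := mem_nodes.1 hv
  ext u
  rw [mem_nodes, mem_nodes, size_insert]
  constructor
  · rintro ⟨⟨h1, h2⟩, h3⟩
    rcases Nat.lt_or_ge T.size u with hu | hu
    · obtain rfl : u = T.size + 1 := by omega
      rw [insert_node_last_of_lt h] at h3; omega
    · rw [insert_node_of_le b T v hu] at h3; exact ⟨⟨h1, hu⟩, h3⟩
  · rintro ⟨⟨h1, h2⟩, h3⟩
    exact ⟨⟨h1, by omega⟩, by rw [insert_node_of_le b T v h2]; exact h3⟩

lemma nodes_insert_of_le {b : ℕ} {T : BucketTree} {v : ℕ} (h : b ≤ T.cap v) :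
    (T.insert b v).nodes = Insert.insert (T.size + 1) T.nodes := by
  ext u
  rw [Finset.mem_insert, mem_nodes, mem_nodes, size_insert]
  constructor
  · rintro ⟨⟨h1, h2⟩, h3⟩
    rcases Nat.lt_or_ge T.size u with hu | hu
    · left; omega
    · right; rw [insert_node_of_le b T v hu] at h3; exact ⟨⟨h1, hu⟩, h3⟩
  · rintro (rfl | ⟨⟨h1, h2⟩, h3⟩)
    · exact ⟨⟨by omega, le_rfl⟩, insert_node_last_of_le h⟩
    · exact ⟨⟨h1, by omega⟩, by rw [insert_node_of_le b T v h2]; exact h3⟩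

lemma size_succ_notMem_nodes (T : BucketTree) : T.size + 1 ∉ T.nodes := by
  intro h; have := mem_nodes.1 h; omega

lemma mem_nodes_insert {b : ℕ} {T : BucketTree} {v u : ℕ} (hv : v ∈ T.nodes)
    (hu : u ∈ (T.insert b v).nodes) : u ∈ T.nodes ∨ (u = T.size + 1 ∧ b ≤ T.cap v) := by
  rcases Nat.lt_or_ge (T.cap v) b with h | h
  · rw [nodes_insert_of_lt hv h] at hu; exact Or.inl hu
  · rw [nodes_insert_of_le h, Finset.mem_insert] at hu
    rcases hu with hu | hu
    · exact Or.inr ⟨hu, h⟩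
    · exact Or.inl hu

lemma filter_node_insert (b : ℕ) (T : BucketTree) (v u : ℕ) :
    (Finset.Icc 1 T.size).filter (fun i => (T.insert b v).node i = u)
      = (Finset.Icc 1 T.size).filter (fun i => T.node i = u) :=
  Finset.filter_congr fun i hi => by rw [insert_node_of_le b T v (Finset.mem_Icc.1 hi).2]

lemma cap_insert (b : ℕ) (T : BucketTree) (v u : ℕ) :
    (T.insert b v).cap u = T.cap u + if (T.insert b v).node (T.size + 1) = u then 1 else 0 := by
  unfold cap
  rw [size_insert, Icc_succ_size, Finset.filter_insert, filter_node_insert]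
  split_ifs with h
  · rw [Finset.card_insert_of_notMem (by simp)]
  · rfl

lemma cap_insert_self_of_lt {b : ℕ} {T : BucketTree} {v : ℕ} (h : T.cap v < b) :
    (T.insert b v).cap v = T.cap v + 1 := by
  rw [cap_insert, insert_node_last_of_lt h, if_pos rfl]

lemma cap_insert_of_ne {b : ℕ} {T : BucketTree} {v u : ℕ} (hu : u ∈ T.nodes) (huv : u ≠ v) :
    (T.insert b v).cap u = T.cap u := by
  have := mem_nodes.1 hu
  rw [cap_insert, if_neg, add_zero]
  rcases Nat.lt_or_ge (T.cap v) b with h | h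
  · rw [insert_node_last_of_lt h]; exact huv.symm
  · rw [insert_node_last_of_le h]; omega

lemma cap_insert_of_le {b : ℕ} {T : BucketTree} {v u : ℕ} (hu : u ∈ T.nodes) (h : b ≤ T.cap v) :
    (T.insert b v).cap u = T.cap u := by
  have := mem_nodes.1 hu
  rw [cap_insert, if_neg, add_zero]
  rw [insert_node_last_of_le h]; omega

/-! ### Increasing labels and subtrees -/

/-- Labels increase along the edges, and only saturated nodes have children. -/
structure Increasing (b : ℕ) (T : BucketTree) : Prop where
  node_le : ∀ i, 1 ≤ i → i ≤ T.size → T.node i ≤ i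
  parent_zero : T.parent 0 = 0
  lt_of_parent : ∀ u ∈ T.nodes, u ≠ 1 → ∀ i, 1 ≤ i → i ≤ T.size → T.node i = T.parent u → i < u
  cap_parent : ∀ u ∈ T.nodes, u ≠ 1 → b ≤ T.cap (T.parent u)

lemma increasing_single (b : ℕ) : single.Increasing b where
  node_le i _ _ := le_rfl
  parent_zero := rfl
  lt_of_parent u _ _ i h1 _ h := by simp [single] at h; omega
  cap_parent u hu hu1 := by
    have := mem_nodes.1 hu
    simp [single] at this; omega

lemma Increasing.insert {F : BucketFamily} {b : ℕ} {T : BucketTree} (hV : T.Valid F b)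
    (h : T.Increasing b) {v : ℕ} (hv : v ∈ T.nodes) : (T.insert b v).Increasing b := by
  have hv' := mem_nodes.1 hv
  refine ⟨?_, ?_, ?_, ?_⟩
  · intro i h1 h2
    rw [size_insert] at h2
    rcases Nat.lt_or_ge T.size i with hi | hi
    · obtain rfl : i = T.size + 1 := by omega
      rcases Nat.lt_or_ge (T.cap v) b with h | h
      · rw [insert_node_last_of_lt h]; omega
      · rw [insert_node_last_of_le h]
    · rw [insert_node_of_le b T v hi]; exact h.node_le i h1 hi
  · rw [insert_parent_of_le b T v (by omega)]; exact h.parent_zero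
  · intro u hu hu1 i h1 h2 hi
    rw [size_insert] at h2
    rcases mem_nodes_insert hv hu with hu | ⟨rfl, hb⟩
    · have hu' := mem_nodes.1 hu
      rw [insert_parent_of_le b T v hu'.1.2] at hi
      rcases Nat.lt_or_ge T.size i with hi' | hi'
      · obtain rfl : i = T.size + 1 := by omega
        have hp := mem_nodes.1 (hV.parent_mem u hu hu1)
        rcases Nat.lt_or_ge (T.cap v) b with hc | hc
        · rw [insert_node_last_of_lt hc] at hi
          -- A bucket that is already a parent is saturated, so the new largest label cannot enter
          -- it and spoil the order.
          have := h.cap_parent u hu hu1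
          rw [← hi] at this; omega
        · rw [insert_node_last_of_le hc] at hi; omega
      · rw [insert_node_of_le b T v hi'] at hi
        exact h.lt_of_parent u hu hu1 i h1 hi' hi
    · rw [insert_parent_last_of_le hb] at hi
      by_contra hlt
      obtain rfl : i = T.size + 1 := by omega
      rw [insert_node_last_of_le hb] at hi; omega
  · intro u hu hu1
    -- Capacities never decrease, so it suffices that the parent was saturated before the insertion.
    refine le_trans ?_ ((cap_insert b T v _).symm ▸ Nat.le_add_right _ _)
    rcases mem_nodes_insert hv hu with hu | ⟨rfl, hb⟩
    · rw [insert_parent_of_le b T v (mem_nodes.1 hu).1.2]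
      exact h.cap_parent u hu hu1
    · rwa [insert_parent_last_of_le hb]

lemma Increasing.parent_lt {F : BucketFamily} {b : ℕ} {T : BucketTree} (hV : T.Valid F b)
    (h : T.Increasing b) {u : ℕ} (hu : u ∈ T.nodes) : T.parent u < u := by
  have hu' := mem_nodes.1 hu
  by_cases hu1 : u = 1
  · subst hu1; rw [hV.root_parent]; omega
  · have hp := mem_nodes.1 (hV.parent_mem u hu hu1)
    exact h.lt_of_parent u hu hu1 _ hp.1.1 hp.1.2 hp.2

lemma inSubtree_self (T : BucketTree) (r : ℕ) : T.InSubtree r r := ⟨0, rfl⟩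

lemma inSubtree_iff (T : BucketTree) {r u : ℕ} :
    T.InSubtree r u ↔ u = r ∨ T.InSubtree r (T.parent u) := by
  constructor
  · rintro ⟨k, hk⟩
    cases k with
    | zero => exact Or.inl hk
    | succ k => exact Or.inr ⟨k, hk⟩
  · rintro (rfl | ⟨k, hk⟩)
    · exact inSubtree_self T _
    · exact ⟨k + 1, hk⟩

/-- The value 0 that marks the missing parent of the root is a fixed point of `parent`. A chain of
ancestors that leaves the tree through the root therefore stays outside, and stopping at 0 is
harmless. -/
lemma Increasing.not_inSubtree_zero {b : ℕ} {T : BucketTree} (h : T.Increasing b) {r : ℕ}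
    (hr : r ≠ 0) : ¬ T.InSubtree r 0 := by
  rintro ⟨k, hk⟩
  rw [Function.iterate_fixed h.parent_zero] at hk
  exact hr hk.symm

/-- A proper descendant of the bucket of the label `j` is named by a label larger than `j`. -/
lemma Increasing.lt_of_inSubtree {F : BucketFamily} {b : ℕ} {T : BucketTree} (hV : T.Valid F b)
    (h : T.Increasing b) {j : ℕ} (h1 : 1 ≤ j) (hj : j ≤ T.size) {u : ℕ} (hu : u ∈ T.nodes)
    (hs : T.InSubtree (T.node j) u) : u = T.node j ∨ j < u := by
  have hr := mem_nodes.1 (hV.node_mem j (Finset.mem_Icc.2 ⟨h1, hj⟩))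
  induction u using Nat.strong_induction_on with
  | _ u ih =>
    rcases T.inSubtree_iff.1 hs with hs | hs
    · exact Or.inl hs
    · right
      have hu1 : u ≠ 1 := by
        rintro rfl
        rw [hV.root_parent] at hs
        exact h.not_inSubtree_zero (by omega) hs
      have hlt := h.parent_lt hV hu
      -- Induction along the ancestor chain: the parent is either the bucket of j, all of whose
      -- labels are smaller than the name of its child, or it is already named by a label above j.
      rcases ih _ hlt (hV.parent_mem u hu hu1) hs with hp | hp
      · exact h.lt_of_parent u hu hu1 j h1 hj hp.symm
      · omega

/-- An insertion changes `parent` at most at the fresh index `T.size + 1`, and the ancestor chain of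
an old node never visits that index. -/
lemma Increasing.inSubtree_insert {F : BucketFamily} {b : ℕ} {T : BucketTree} (hV : T.Valid F b)
    (h : T.Increasing b) (v r : ℕ) {u : ℕ} (hu : u ∈ T.nodes) :
    (T.insert b v).InSubtree r u ↔ T.InSubtree r u := by
  have key : ∀ k, ((T.insert b v).parent^[k] u = T.parent^[k] u) ∧ T.parent^[k] u ≤ T.size := by
    have hle : ∀ w, w ≤ T.size → w = 0 ∨ w ∈ T.nodes → T.parent w ≤ T.size ∧
        (T.parent w = 0 ∨ T.parent w ∈ T.nodes) := by
      rintro w hw (rfl | hw')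
      · rw [h.parent_zero]; simp
      · by_cases hw1 : w = 1
        · subst hw1; rw [hV.root_parent]; simp
        · have := hV.parent_mem w hw' hw1
          exact ⟨(mem_nodes.1 this).1.2, Or.inr this⟩
    have : ∀ k, ((T.insert b v).parent^[k] u = T.parent^[k] u) ∧ T.parent^[k] u ≤ T.size ∧
        (T.parent^[k] u = 0 ∨ T.parent^[k] u ∈ T.nodes) := by
      intro k
      induction k with
      | zero => exact ⟨rfl, (mem_nodes.1 hu).1.2, Or.inr hu⟩
      | succ k ih =>
        rw [Function.iterate_succ_apply', Function.iterate_succ_apply', ih.1,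
          insert_parent_of_le b T v ih.2.1]
        exact ⟨rfl, hle _ ih.2.1 ih.2.2⟩
    exact fun k => ⟨(this k).1, (this k).2.1⟩
  unfold InSubtree
  simp only [(key _).1]

/-! ### Initial size, descendants and the subtree of a label -/

/-- The number of labels `≤ j` in the bucket of the label `j`, that is, the size of this bucket
at the time at which `j` was inserted. -/
def initialSize (T : BucketTree) (j : ℕ) : ℕ :=
  ((Finset.Icc 1 j).filter fun i => T.node i = T.node j).card

lemma initialSize_insert {b : ℕ} {T : BucketTree} {j : ℕ} (hj : j ≤ T.size) (v : ℕ) :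
    (T.insert b v).initialSize j = T.initialSize j := by
  unfold initialSize
  congr 1
  refine Finset.filter_congr fun i hi => ?_
  rw [insert_node_of_le b T v hj, insert_node_of_le b T v ((Finset.mem_Icc.1 hi).2.trans hj)]

lemma initialSize_size (T : BucketTree) : T.initialSize T.size = T.cap (T.node T.size) := rfl

lemma initialSize_pos (T : BucketTree) {j : ℕ} (hj : 1 ≤ j) : 1 ≤ T.initialSize j :=
  Finset.card_pos.2 ⟨j, by simp [hj]⟩

lemma descendants_pos (T : BucketTree) {j : ℕ} (hj : j ≤ T.size) : 1 ≤ T.descendants j := by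
  classical
  exact Finset.card_pos.2 ⟨j, by simp [hj, inSubtree_self]⟩

lemma descendants_size (T : BucketTree) : T.descendants T.size = 1 := by
  classical
  unfold descendants
  rw [Finset.Icc_self, Finset.filter_singleton, if_pos (inSubtree_self _ _), Finset.card_singleton]

open Classical in
lemma Increasing.descendants_insert {F : BucketFamily} {b : ℕ} {T : BucketTree}
    (hV : T.Valid F b) (h : T.Increasing b) {j : ℕ} (h1 : 1 ≤ j) (hj : j ≤ T.size) {v : ℕ}
    (hv : v ∈ T.nodes) :
    (T.insert b v).descendants j
      = T.descendants j + if T.InSubtree (T.node j) v then 1 else 0 := by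
  have hlast : (T.insert b v).InSubtree (T.node j) ((T.insert b v).node (T.size + 1)) ↔
      T.InSubtree (T.node j) v := by
    rcases Nat.lt_or_ge (T.cap v) b with hc | hc
    · rw [insert_node_last_of_lt hc, h.inSubtree_insert hV _ _ hv]
    · rw [insert_node_last_of_le hc, inSubtree_iff, insert_parent_last_of_le hc,
        h.inSubtree_insert hV _ _ hv]
      have := h.node_le j h1 hj
      -- A fresh bucket is named by the new label, hence is not the bucket of j; it lies in the
      -- subtree exactly when its parent v does.
      refine or_iff_right (by omega)
  have hI : Finset.Icc j (T.size + 1) = Insert.insert (T.size + 1) (Finset.Icc j T.size) := by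
    ext i; simp only [Finset.mem_Icc, Finset.mem_insert]; omega
  have hf : (Finset.Icc j T.size).filter (fun i => (T.insert b v).InSubtree (T.node j)
      ((T.insert b v).node i)) = (Finset.Icc j T.size).filter (fun i => T.InSubtree (T.node j)
      (T.node i)) := by
    refine Finset.filter_congr fun i hi => ?_
    rw [Finset.mem_Icc] at hi
    rw [insert_node_of_le b T v hi.2, h.inSubtree_insert hV]
    exact hV.node_mem i (Finset.mem_Icc.2 ⟨h1.trans hi.1, hi.2⟩)
  unfold descendants
  rw [size_insert, insert_node_of_le b T v hj, hI, Finset.filter_insert, hf]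
  simp only [hlast]
  split_ifs
  · rw [Finset.card_insert_of_notMem (by simp)]
  · rfl

open Classical in
/-- The nodes of the subtree rooted at the bucket of the label `j`. -/
noncomputable def subtreeNodes (T : BucketTree) (j : ℕ) : Finset ℕ :=
  T.nodes.filter fun u => T.InSubtree (T.node j) u

/-- Proper descendants of the bucket of j carry only labels above j. The labels of the subtree are
thus those of this bucket up to j, together with the descendants of j; the label j belongs to both
groups, which accounts for the 1. -/
lemma Increasing.sum_cap_subtree {F : BucketFamily} {b : ℕ} {T : BucketTree}
    (hV : T.Valid F b) (h : T.Increasing b) {j : ℕ} (h1 : 1 ≤ j) (hj : j ≤ T.size) :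
    ∑ v ∈ T.subtreeNodes j, T.cap v + 1 = T.initialSize j + T.descendants j := by
  classical
  have hfib := Finset.card_eq_sum_card_fiberwise (f := T.node)
    (s := (Finset.Icc 1 T.size).filter fun i => T.InSubtree (T.node j) (T.node i))
    (t := T.subtreeNodes j) (fun i hi => by
      simp only [Finset.coe_filter, Set.mem_ofPred_eq] at hi
      simp only [subtreeNodes, Finset.coe_filter, Set.mem_ofPred_eq]
      exact ⟨hV.node_mem i hi.1, hi.2⟩)
  have hcap : ∑ v ∈ T.subtreeNodes j, T.cap v
      = ((Finset.Icc 1 T.size).filter fun i => T.InSubtree (T.node j) (T.node i)).card := by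
    rw [hfib]
    refine Finset.sum_congr rfl fun v hv => ?_
    unfold cap
    rw [Finset.filter_filter]
    congr 1
    refine Finset.filter_congr fun i _ => ⟨fun hi => ⟨?_, hi⟩, fun hi => hi.2⟩
    rw [hi]; exact (Finset.mem_filter.1 hv).2
  have hsplit : ((Finset.Icc 1 T.size).filter fun i => T.InSubtree (T.node j) (T.node i))
      = ((Finset.Icc 1 j).filter fun i => T.node i = T.node j).erase j ∪
        (Finset.Icc j T.size).filter fun i => T.InSubtree (T.node j) (T.node i) := by
    ext i
    simp only [Finset.mem_filter, Finset.mem_union, Finset.mem_erase, Finset.mem_Icc]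
    constructor
    · rintro ⟨⟨hi1, hi2⟩, hi⟩
      rcases Nat.lt_or_ge i j with hij | hij
      · left
        refine ⟨by omega, ⟨hi1, by omega⟩, ?_⟩
        rcases h.lt_of_inSubtree hV h1 hj (hV.node_mem i (Finset.mem_Icc.2 ⟨hi1, hi2⟩)) hi with h' | h'
        · exact h'
        · have := h.node_le i hi1 hi2; omega
      · exact Or.inr ⟨⟨hij, hi2⟩, hi⟩
    · rintro (⟨_, ⟨hi1, hi2⟩, hi⟩ | ⟨⟨hi1, hi2⟩, hi⟩)
      · rw [hi]; exact ⟨⟨hi1, by omega⟩, inSubtree_self _ _⟩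
      · exact ⟨⟨by omega, hi2⟩, hi⟩
  rw [hcap, hsplit, Finset.card_union_of_disjoint]
  · have : j ∈ (Finset.Icc 1 j).filter fun i => T.node i = T.node j := by simp [h1]
    rw [initialSize, descendants, ← Finset.card_erase_add_one this]
    ring
  · rw [Finset.disjoint_left]
    intro i hi hi'
    simp only [Finset.mem_erase, Finset.mem_filter, Finset.mem_Icc] at hi hi'
    omega

/-- A tree has one edge fewer than nodes: every node of the subtree except its root is the child of
exactly one node of the subtree. -/
lemma Increasing.sum_outdeg_subtree {F : BucketFamily} {b : ℕ} {T : BucketTree}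
    (hV : T.Valid F b) (h : T.Increasing b) {j : ℕ} (h1 : 1 ≤ j) (hj : j ≤ T.size) :
    ∑ v ∈ T.subtreeNodes j, T.outdeg v + 1 = (T.subtreeNodes j).card := by
  classical
  have hrn := hV.node_mem j (Finset.mem_Icc.2 ⟨h1, hj⟩)
  have hr := mem_nodes.1 hrn
  have hmem : T.node j ∈ T.subtreeNodes j :=
    Finset.mem_filter.2 ⟨hrn, inSubtree_self _ _⟩
  have hne : ∀ u, T.InSubtree (T.node j) (T.parent u) → u ≠ 1 := by
    rintro u hu rfl
    rw [hV.root_parent] at hu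
    exact h.not_inSubtree_zero (by omega) hu
  have := Finset.card_eq_sum_card_fiberwise (f := T.parent) (s := (T.subtreeNodes j).erase (T.node j))
    (t := T.subtreeNodes j) (fun i hi => by
      have hi' := Finset.mem_erase.1 hi
      have hi2 := Finset.mem_filter.1 hi'.2
      have hi3 := (T.inSubtree_iff.1 hi2.2).resolve_left hi'.1
      exact Finset.mem_filter.2 ⟨hV.parent_mem i hi2.1 (hne i hi3), hi3⟩)
  rw [← Finset.card_erase_add_one hmem, this]
  congr 1
  refine Finset.sum_congr rfl fun v hv => ?_
  have hv' := Finset.mem_filter.1 hv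
  unfold outdeg
  congr 1
  ext u
  simp only [Finset.mem_filter, Finset.mem_erase, subtreeNodes]
  constructor
  · rintro ⟨hu, hp⟩
    subst hp
    refine ⟨⟨?_, hu, T.inSubtree_iff.2 (Or.inr hv'.2)⟩, rfl⟩
    rintro rfl
    -- The root of the subtree is not a child inside it: its parent has a smaller name, whereas
    -- every node of the subtree is the root itself or is named above j.
    have hlt := h.parent_lt hV hu
    have hle := h.node_le j h1 hj
    rcases h.lt_of_inSubtree hV h1 hj hv'.1 hv'.2 with h' | h' <;> omega
  · rintro ⟨⟨_, hu, _⟩, hp⟩; exact ⟨hu, hp⟩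

end BucketTree

/-! ### The attraction probability of a subtree -/

namespace BucketFamily

/-- Dividing numerator and denominator by d − 1 or α + 1 brings the three families to one form that
depends on κ only. No case distinction between the families is needed afterwards. -/
lemma attractProb_eq (F : BucketFamily) {n : ℕ} (hn : 1 ≤ n) (c deg : ℕ) :
    F.attractProb n c deg = (c + F.kappa * (1 - deg)) / (n + F.kappa) := by
  have hpos := F.add_kappa_pos hn
  have hn1 : (1 : ℝ) ≤ n := by exact_mod_cast hn
  cases F with
  | recursive => simp [attractProb, kappa]
  | ary d hd =>
    have hd' : (2 : ℝ) ≤ d := by exact_mod_cast hd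
    have h1 : (d : ℝ) - 1 ≠ 0 := by linarith
    simp only [attractProb, kappa] at hpos ⊢
    rw [div_eq_div_iff (by nlinarith) hpos.ne']
    field_simp
    ring
  | port α hα =>
    have h1 : α + 1 ≠ 0 := by linarith
    simp only [attractProb, kappa] at hpos ⊢
    rw [div_eq_div_iff (by nlinarith) hpos.ne']
    field_simp
    ring

/-- The subtree of the bucket of `j` attracts the next label like the first colour in a Pólya
urn. -/
lemma sum_attractProb_subtree (F : BucketFamily) {b : ℕ} {T : BucketTree} (hV : T.Valid F b)
    (h : T.Increasing b) {j : ℕ} (h1 : 1 ≤ j) (hj : j ≤ T.size) :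
    ∑ v ∈ T.subtreeNodes j, F.attractProb T.size (T.cap v) (T.outdeg v)
      = (T.initialSize j + T.descendants j - 1 + F.kappa) / (T.size + F.kappa) := by
  have hc : ∑ v ∈ T.subtreeNodes j, (T.cap v : ℝ) + 1 = T.initialSize j + T.descendants j := by
    exact_mod_cast h.sum_cap_subtree hV h1 hj
  have ho : ∑ v ∈ T.subtreeNodes j, (T.outdeg v : ℝ) + 1 = (T.subtreeNodes j).card := by
    exact_mod_cast h.sum_outdeg_subtree hV h1 hj
  simp only [F.attractProb_eq hV.size_pos]
  rw [← Finset.sum_div, Finset.sum_add_distrib, ← Finset.mul_sum, Finset.sum_sub_distrib]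
  congr 1
  simp only [Finset.sum_const, nsmul_eq_mul, mul_one]
  -- Nodes minus edges equals 1, so the κ-terms collapse to one κ.
  rw [← ho, ← hc]
  ring

end BucketFamily

/-! ### Integration against the law of the random tree -/

namespace BucketFamily

lemma measurable_of_bucketTree {β : Type*} [MeasurableSpace β] (f : BucketTree → β) :
    Measurable f := fun _ _ => trivial

lemma lintegral_growthStep (F : BucketFamily) (b : ℕ) (T : BucketTree) (f : BucketTree → ENNReal) :
    ∫⁻ T', f T' ∂(F.growthStep b T) = ∑ v ∈ T.nodes,
      ENNReal.ofReal (F.attractProb T.size (T.cap v) (T.outdeg v)) * f (T.insert b v) := by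
  unfold growthStep
  rw [lintegral_finsetSum_measure]
  simp only [lintegral_smul_measure, lintegral_dirac' _ (measurable_of_bucketTree f), smul_eq_mul]

/-- Averaging over the node that attracts the last label. Every recursion in n below is this
identity applied to a suitable statistic. -/
lemma lintegral_treeLaw_succ (F : BucketFamily) (b : ℕ) {n : ℕ} (hn : 1 ≤ n)
    (f : BucketTree → ENNReal) :
    ∫⁻ T, f T ∂(F.treeLaw b (n + 1)) = ∫⁻ T, ∑ v ∈ T.nodes,
      ENNReal.ofReal (F.attractProb T.size (T.cap v) (T.outdeg v)) * f (T.insert b v)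
        ∂(F.treeLaw b n) := by
  obtain ⟨k, rfl⟩ := Nat.exists_eq_add_of_le' hn
  simp only [treeLaw, Nat.add_sub_cancel, growth]
  rw [Measure.lintegral_bind (aemeasurable_of_bucketTree _ _) (aemeasurable_of_bucketTree _ _)]
  simp only [lintegral_growthStep]

lemma ae_growthStep_increasing (F : BucketFamily) {b : ℕ} {T : BucketTree} (hV : T.Valid F b)
    (h : T.Increasing b) : ∀ᵐ T' ∂(F.growthStep b T), T'.Increasing b := by
  rw [ae_iff]
  simp only [growthStep, Measure.coe_finsetSum, Finset.sum_apply, Measure.smul_apply, smul_eq_mul]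
  refine Finset.sum_eq_zero fun v hv => ?_
  rw [Measure.dirac_apply' _ (measurableSet_bucketTree _), Set.indicator_of_notMem]
  · simp
  · simpa using h.insert hV hv

lemma ae_growth_increasing (F : BucketFamily) (b k : ℕ) :
    ∀ᵐ T ∂(F.growth b k), T.Increasing b := by
  induction k with
  | zero =>
    rw [ae_iff]
    simp only [growth]
    rw [Measure.dirac_apply' _ (measurableSet_bucketTree _), Set.indicator_of_notMem]
    simpa using BucketTree.increasing_single b
  | succ k ih =>
    rw [ae_iff]
    simp only [growth]
    rw [Measure.bind_apply (measurableSet_bucketTree _) (aemeasurable_of_bucketTree _ _),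
      lintegral_eq_zero_iff' (aemeasurable_of_bucketTree _ _)]
    filter_upwards [ih, (F.growth_spec b k).2] with T hT hV
    have := F.ae_growthStep_increasing hV.1 hT
    rw [ae_iff] at this
    exact this

lemma ae_treeLaw (F : BucketFamily) (b : ℕ) {n : ℕ} (hn : 1 ≤ n) :
    ∀ᵐ T ∂(F.treeLaw b n), T.Valid F b ∧ T.Increasing b ∧ T.size = n := by
  filter_upwards [(F.growth_spec b (n - 1)).2, F.ae_growth_increasing b (n - 1)] with T h1 h2
  exact ⟨h1.1, h2, by omega⟩

lemma sum_ofReal_attractProb (F : BucketFamily) {b : ℕ} {T : BucketTree} (hV : T.Valid F b) :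
    ∑ v ∈ T.nodes, ENNReal.ofReal (F.attractProb T.size (T.cap v) (T.outdeg v)) = 1 := by
  rw [← ENNReal.ofReal_sum_of_nonneg hV.prob_nonneg, hV.sum_attractProb, ENNReal.ofReal_one]

end BucketFamily

/-! ### Pólya–Eggenberger weights -/

/-- The Pólya–Eggenberger (beta-binomial) weight: the probability of `m` successes in `N` draws from
a Pólya urn with initial weights `r` and `s`. -/
noncomputable def polyaWeight (r s : ℝ) (N m : ℕ) : ℝ :=
  (∏ i ∈ Finset.range m, (r + i) / (i + 1)) * (∏ i ∈ Finset.range N, (s + i) / (r + s + i)) *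
    ∏ i ∈ Finset.range m, ((N : ℝ) - i) / (s + N - 1 - i)

lemma polyaWeight_eq_zero (r s : ℝ) {N m : ℕ} (h : N < m) : polyaWeight r s N m = 0 := by
  unfold polyaWeight
  rw [Finset.prod_eq_zero (i := N) (s := Finset.range m) (f := fun i : ℕ => ((N : ℝ) - i) / _)
    (Finset.mem_range.2 h) (by simp), mul_zero]

lemma polyaWeight_nonneg {r s : ℝ} (hr : 0 < r) (hs : 1 ≤ s) (N m : ℕ) :
    0 ≤ polyaWeight r s N m := by
  rcases Nat.lt_or_ge N m with h | h
  · rw [polyaWeight_eq_zero r s h]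
  · unfold polyaWeight
    refine mul_nonneg (mul_nonneg ?_ ?_) ?_ <;> refine Finset.prod_nonneg fun i hi => ?_
    · positivity
    · have : 0 < s := by linarith
      positivity
    · have : ((i + 1 : ℕ) : ℝ) ≤ N := by exact_mod_cast (Finset.mem_range.1 hi).trans_le h
      push_cast at this
      refine div_nonneg ?_ ?_ <;> linarith

lemma polyaWeight_zero (r s : ℝ) (m : ℕ) : polyaWeight r s 0 m = if m = 0 then 1 else 0 := by
  split_ifs with h
  · subst h; simp [polyaWeight]
  · exact polyaWeight_eq_zero r s (Nat.pos_of_ne_zero h)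

/-- The factor for i = 0 is split off; the remaining ones are those for N with the index shifted by
one. -/
lemma prod_div_succ (s : ℝ) (N m : ℕ) :
    ∏ i ∈ Finset.range (m + 1), (((N + 1 : ℕ) : ℝ) - i) / (s + ((N + 1 : ℕ) : ℝ) - 1 - i)
      = (N + 1) / (s + N) * ∏ i ∈ Finset.range m, ((N : ℝ) - i) / (s + N - 1 - i) := by
  rw [Finset.prod_range_succ', mul_comm]
  congr 1
  · push_cast; congr 1 <;> ring
  · refine Finset.prod_congr rfl fun i _ => ?_
    push_cast; congr 1 <;> ring

lemma polyaWeight_succ_zero {r s : ℝ} (N : ℕ) :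
    polyaWeight r s (N + 1) 0 = polyaWeight r s N 0 * ((s + N) / (r + s + N)) := by
  simp only [polyaWeight, Finset.prod_range_succ, Finset.prod_range_zero]
  ring

/-- Conditioning on the last draw: either all m + 1 successes have already occurred and it fails, or
m have occurred and it succeeds. -/
lemma polyaWeight_succ_succ {r s : ℝ} (hr : 0 < r) (hs : 1 ≤ s) {N m : ℕ} (hm : m ≤ N) :
    polyaWeight r s (N + 1) (m + 1) =
      polyaWeight r s N (m + 1) * ((s + N - (m + 1)) / (r + s + N)) +
        polyaWeight r s N m * ((r + m) / (r + s + N)) := by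
  have hmN : (m : ℝ) ≤ N := by exact_mod_cast hm
  unfold polyaWeight
  rw [prod_div_succ, Finset.prod_range_succ _ N, Finset.prod_range_succ _ m,
    Finset.prod_range_succ (fun i : ℕ => ((N : ℝ) - i) / (s + N - 1 - i)) m]
  set A := ∏ i ∈ Finset.range m, (r + i) / ((i : ℝ) + 1)
  set B := ∏ i ∈ Finset.range N, (s + i) / (r + s + i)
  set C := ∏ i ∈ Finset.range m, ((N : ℝ) - i) / (s + N - 1 - i)
  have h1 : (m : ℝ) + 1 ≠ 0 := by positivity
  have h2 : s + N ≠ 0 := by positivity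
  have h3 : r + s + N ≠ 0 := by positivity
  -- The denominator vanishes only for s = 1 and m = N, where division by zero gives 0, in agreement
  -- with N − m = 0.
  have key : ((N : ℝ) - m) / (s + N - 1 - m) * (s + N - (m + 1)) = N - m := by
    rcases eq_or_ne (s + N - 1 - m) 0 with h | h
    · have : (N : ℝ) - m = 0 := by linarith
      simp [this]
    · rw [show s + N - (m + 1) = s + N - 1 - m by ring]; field_simp
  calc _ = A * B * C * ((r + m) / (m + 1) * ((N + 1) / (r + s + N))) := by field_simp
    _ = A * B * C * ((r + m) / (m + 1) * (N - m) / (r + s + N) + (r + m) / (r + s + N)) := by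
      field_simp; ring
    _ = A * B * C * ((r + m) / (m + 1) * (((N : ℝ) - m) / (s + N - 1 - m) * (s + N - (m + 1))) /
        (r + s + N) + (r + m) / (r + s + N)) := by rw [key]
    _ = _ := by ring

/-! ### The joint law of initial size and number of descendants -/

namespace BucketFamily

/-- One step of the joint evolution of the initial size and of the number of descendants. -/
lemma treeLaw_succ_descendants (F : BucketFamily) (b : ℕ) {j n : ℕ} (h1 : 1 ≤ j) (hn : j ≤ n)
    (l m : ℕ) :
    F.treeLaw b (n + 1) {T | T.initialSize j = l ∧ T.descendants j = m + 1} =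
      F.treeLaw b n {T | T.initialSize j = l ∧ T.descendants j = m + 1} *
          ENNReal.ofReal ((n - l - m) / (n + F.kappa)) +
        F.treeLaw b n {T | T.initialSize j = l ∧ T.descendants j = m} *
          ENNReal.ofReal ((l + m - 1 + F.kappa) / (n + F.kappa)) := by
  classical
  rw [← lintegral_indicator_one (measurableSet_bucketTree _),
    F.lintegral_treeLaw_succ b (h1.trans hn),
    ← lintegral_indicator_one (measurableSet_bucketTree _),
    ← lintegral_indicator_one (measurableSet_bucketTree _),
    ← lintegral_mul_const _ (measurable_of_bucketTree _),
    ← lintegral_mul_const _ (measurable_of_bucketTree _),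
    ← lintegral_add_left (measurable_of_bucketTree _)]
  refine lintegral_congr_ae ?_
  filter_upwards [F.ae_treeLaw b (h1.trans hn)] with T ⟨hV, hI, hs⟩
  have hjs : j ≤ T.size := by omega
  have hsub := F.sum_attractProb_subtree hV hI h1 hjs
  have htot := hV.sum_attractProb
  -- The attracting node is split according to whether it lies in the subtree: if so, the number of
  -- descendants grows by one; otherwise it stays. The initial size is frozen in both cases.
  rw [← Finset.sum_filter_add_sum_filter_not T.nodes
    (fun u => T.InSubtree (T.node j) u)] at htot ⊢
  change ∑ v ∈ T.subtreeNodes j, _ + _ = _ at htot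
  rw [hsub] at htot
  have hpos : 0 < (n : ℝ) + F.kappa := F.add_kappa_pos (h1.trans hn)
  have hin : ∀ v ∈ T.nodes.filter (fun u => T.InSubtree (T.node j) u),
      ENNReal.ofReal (F.attractProb T.size (T.cap v) (T.outdeg v)) *
        Set.indicator {T | T.initialSize j = l ∧ T.descendants j = m + 1} 1 (T.insert b v) =
      ENNReal.ofReal (F.attractProb T.size (T.cap v) (T.outdeg v)) *
        Set.indicator {T | T.initialSize j = l ∧ T.descendants j = m} 1 T := by
    intro v hv
    have hv' := Finset.mem_filter.1 hv
    congr 1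
    simp only [Set.indicator_apply, Set.mem_ofPred_eq, BucketTree.initialSize_insert hjs,
      hI.descendants_insert hV h1 hjs hv'.1, if_pos hv'.2, add_left_inj, Pi.one_apply]
  have hout : ∀ v ∈ T.nodes.filter (fun u => ¬ T.InSubtree (T.node j) u),
      ENNReal.ofReal (F.attractProb T.size (T.cap v) (T.outdeg v)) *
        Set.indicator {T | T.initialSize j = l ∧ T.descendants j = m + 1} 1 (T.insert b v) =
      ENNReal.ofReal (F.attractProb T.size (T.cap v) (T.outdeg v)) *
        Set.indicator {T | T.initialSize j = l ∧ T.descendants j = m + 1} 1 T := by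
    intro v hv
    have hv' := Finset.mem_filter.1 hv
    congr 1
    simp only [Set.indicator_apply, Set.mem_ofPred_eq, BucketTree.initialSize_insert hjs,
      hI.descendants_insert hV h1 hjs hv'.1, if_neg hv'.2, add_zero, Pi.one_apply]
  rw [Finset.sum_congr rfl hin, Finset.sum_congr rfl hout, ← Finset.sum_mul, ← Finset.sum_mul,
    ← ENNReal.ofReal_sum_of_nonneg (fun v hv => hV.prob_nonneg v (Finset.mem_filter.1 hv).1),
    ← ENNReal.ofReal_sum_of_nonneg (fun v hv => hV.prob_nonneg v (Finset.mem_filter.1 hv).1)]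
  change ENNReal.ofReal (∑ v ∈ T.subtreeNodes j, _) * _ + _ = _
  rw [hsub, eq_sub_of_add_eq' htot, hs, add_comm]
  congr 1
  · by_cases hT : T.initialSize j = l ∧ T.descendants j = m + 1
    · rw [mul_comm, hT.1, hT.2]
      congr 2
      rw [eq_div_iff hpos.ne', sub_mul, div_mul_cancel₀ _ hpos.ne']
      push_cast; ring
    · simp [hT]
  · by_cases hT : T.initialSize j = l ∧ T.descendants j = m
    · rw [mul_comm, hT.1, hT.2]
    · simp [hT]

lemma treeLaw_initialSize_self (F : BucketFamily) (b : ℕ) {j : ℕ} (hj : 1 ≤ j) (l m : ℕ) :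
    F.treeLaw b j {T | T.initialSize j = l ∧ T.descendants j = m + 1} =
      if m = 0 then F.treeLaw b j {T | T.cap (T.node j) = l} else 0 := by
  split_ifs with hm
  · refine measure_congr (eventuallyEq_set.2 ?_)
    filter_upwards [F.ae_treeLaw b hj] with T ⟨_, _, hs⟩
    subst hs hm
    simp [T.initialSize_size, T.descendants_size]
  · rw [measure_eq_zero_iff_ae_notMem]
    filter_upwards [F.ae_treeLaw b hj] with T ⟨_, _, hs⟩
    subst hs
    simpa [T.descendants_size] using fun _ => hm

/-- The joint law of the initial size of the bucket of `j` and of its number of descendants. -/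
lemma treeLaw_initialSize_descendants (F : BucketFamily) (b : ℕ) {j l : ℕ} (hl : 1 ≤ l)
    (hlj : l < j) (N m : ℕ) :
    F.treeLaw b (j + N) {T | T.initialSize j = l ∧ T.descendants j = m + 1} =
      F.treeLaw b j {T | T.cap (T.node j) = l} *
        ENNReal.ofReal (polyaWeight (l + F.kappa) (j - l) N m) := by
  have hr := F.add_kappa_pos hl
  have hs : (1 : ℝ) ≤ j - l := by
    have : ((l + 1 : ℕ) : ℝ) ≤ j := by exact_mod_cast hlj
    push_cast at this; linarith
  -- Each new label is one draw from the urn. Its weights start at l + κ and j − l and add up to j +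
  -- κ, which matches the denominator n + κ after n − j draws.
  induction N generalizing m with
  | zero =>
    rw [add_zero, F.treeLaw_initialSize_self b (by omega), polyaWeight_zero]
    split_ifs <;> simp
  | succ N ih =>
    rw [← add_assoc, F.treeLaw_succ_descendants b (by omega) (by omega), ih, mul_assoc,
      ← ENNReal.ofReal_mul (polyaWeight_nonneg hr hs _ _)]
    cases m with
    | zero =>
      -- The label j is its own descendant, so for m = 0 there is no contribution from a successful
      -- last draw.
      have h0 : F.treeLaw b (j + N) {T | T.initialSize j = l ∧ T.descendants j = 0} = 0 := by
        rw [measure_eq_zero_iff_ae_notMem]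
        filter_upwards [F.ae_treeLaw b (n := j + N) (by omega)] with T ⟨_, _, hs⟩
        have := T.descendants_pos (j := j) (by omega)
        simpa using fun _ => by omega
      rw [h0, zero_mul, add_zero, polyaWeight_succ_zero]
      push_cast
      congr 4 <;> ring
    | succ m =>
      rw [ih, mul_assoc, ← ENNReal.ofReal_mul (polyaWeight_nonneg hr hs _ _), ← mul_add]
      congr 1
      rcases Nat.lt_or_ge N m with hm | hm
      · simp [polyaWeight_eq_zero _ _ hm, polyaWeight_eq_zero _ _ (hm.trans (Nat.lt_succ_self m)),
          polyaWeight_eq_zero _ _ (Nat.succ_lt_succ hm)]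
      · have hmN : (m : ℝ) ≤ N := by exact_mod_cast hm
        have hN : 0 < ((j + N : ℕ) : ℝ) + F.kappa := F.add_kappa_pos (by omega)
        rw [← ENNReal.ofReal_add, polyaWeight_succ_succ hr hs hm]
        · push_cast
          congr 4 <;> ring
        · refine mul_nonneg (polyaWeight_nonneg hr hs _ _) (div_nonneg ?_ hN.le)
          push_cast; linarith
        · refine mul_nonneg (polyaWeight_nonneg hr hs _ _) (div_nonneg ?_ hN.le)
          push_cast
          have : (0 : ℝ) ≤ m := by positivity
          linarith

lemma ae_cap_node (F : BucketFamily) {b j : ℕ} (hb : 1 ≤ b) (hj : 1 ≤ j) :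
    ∀ᵐ T ∂(F.treeLaw b j), 1 ≤ T.cap (T.node j) ∧ T.cap (T.node j) ≤ b := by
  have := F.ae_initialSizeLaw hb hj
  unfold initialSizeLaw at this
  rwa [ae_map_iff (aemeasurable_of_bucketTree _ _) (by measurability)] at this

lemma sum_treeLaw_cap_node (F : BucketFamily) {b n : ℕ} (hb : 1 ≤ b) (hn : 1 ≤ n) :
    ∑ l ∈ Finset.Icc 1 b, F.treeLaw b n {T | T.cap (T.node n) = l} = 1 := by
  rw [← measure_biUnion_finset
      (fun l _ l' _ hll' => Set.disjoint_left.2 fun T h h' => hll' (h.symm.trans h'))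
      (fun _ _ => measurableSet_bucketTree _), ← measure_univ (μ := F.treeLaw b n)]
  refine measure_congr (eventuallyEq_set.2 ?_)
  filter_upwards [F.ae_cap_node hb hn] with T hT
  simpa using hT

end BucketFamily

/-! ### Averaging along a cycle -/

/-- By 1 − y ≤ exp(−y), the product of the contraction factors is at most exp(−ε ∑ 1/t n), and ∑ 1/t
n diverges by comparison with half the harmonic series. -/
lemma tendsto_zero_of_le_mul_one_sub_div {e t : ℕ → ℝ} {ε : ℝ} (hε : 0 < ε) (he : ∀ n, 0 ≤ e n)
    {n₀ : ℕ} (ht : ∀ n ≥ n₀, 0 < t n ∧ t n ≤ 2 * (n + 1))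
    (h : ∀ n ≥ n₀, e (n + 1) ≤ e n * (1 - ε / t n)) :
    Tendsto e atTop (𝓝 0) := by
  have hns : ¬ Summable (fun k : ℕ => 1 / t (k + n₀)) := by
    intro hs
    have h1 : Summable (fun k : ℕ => (1 / 2 : ℝ) * (1 / ((k + (n₀ + 1) : ℕ) : ℝ))) := by
      refine Summable.of_nonneg_of_le (fun k => by positivity) (fun k => ?_) hs
      obtain ⟨h1, h2⟩ := ht (k + n₀) (by omega)
      rw [one_div_mul_one_div]
      refine one_div_le_one_div_of_le h1 (h2.trans (le_of_eq ?_))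
      push_cast; ring
    rw [summable_mul_left_iff (by norm_num)] at h1
    exact Real.not_summable_one_div_natCast
      ((summable_nat_add_iff (f := fun n : ℕ => 1 / (n : ℝ)) (n₀ + 1)).1 h1)
  have hdiv := (not_summable_iff_tendsto_nat_atTop_of_nonneg
    (fun k => (one_div_pos.2 (ht (k + n₀) (by omega)).1).le)).1 hns
  have hbound : ∀ k, e (k + n₀) ≤
      e n₀ * Real.exp (-(ε * ∑ i ∈ Finset.range k, 1 / t (i + n₀))) := by
    intro k
    induction k with
    | zero => simp
    | succ k ih =>
      rw [Finset.sum_range_succ, mul_add, neg_add, Real.exp_add, ← mul_assoc]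
      have h1 := h (k + n₀) (by omega)
      rw [show k + n₀ + 1 = k + 1 + n₀ by ring] at h1
      have h2 : 1 - ε / t (k + n₀) ≤ Real.exp (-(ε * (1 / t (k + n₀)))) := by
        have := Real.add_one_le_exp (-(ε * (1 / t (k + n₀))))
        rw [mul_one_div] at this ⊢; linarith
      calc _ ≤ _ := h1
        _ ≤ e (k + n₀) * Real.exp (-(ε * (1 / t (k + n₀)))) :=
          mul_le_mul_of_nonneg_left h2 (he _)
        _ ≤ _ := mul_le_mul_of_nonneg_right ih (Real.exp_pos _).le
  rw [← tendsto_add_atTop_iff_nat n₀]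
  refine squeeze_zero (fun k => he _) hbound ?_
  have := (Real.tendsto_exp_neg_atTop_nhds_zero.comp (hdiv.const_mul_atTop hε)).const_mul (e n₀)
  simpa [Function.comp_def] using this

section CyclicAveraging

variable {ι : Type*} [Fintype ι]

lemma abs_sub_iterate_le (σ : Equiv.Perm ι) (x : ι → ℝ) (i : ι) (k : ℕ) :
    |x (σ^[k] i) - x i| ≤ k * √(∑ i, (x (σ i) - x i) ^ 2) := by
  induction k with
  | zero => simp
  | succ k ih =>
    rw [Function.iterate_succ_apply']
    have h1 : |x (σ (σ^[k] i)) - x (σ^[k] i)| ≤ √(∑ i, (x (σ i) - x i) ^ 2) := by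
      rw [← Real.sqrt_sq_eq_abs]
      exact Real.sqrt_le_sqrt (Finset.single_le_sum (f := fun i => (x (σ i) - x i) ^ 2)
        (fun i _ => sq_nonneg _) (Finset.mem_univ _))
    calc _ = |(x (σ (σ^[k] i)) - x (σ^[k] i)) + (x (σ^[k] i) - x i)| := by ring_nf
      _ ≤ _ := (abs_add_le _ _).trans (add_le_add h1 ih)
      _ = _ := by push_cast; ring

/-- Summation by parts: expanding the squares, the terms x (σ i)² and x i² have the same sum because
σ is a permutation. -/
lemma sum_mul_sub_perm (σ : Equiv.Perm ι) (x : ι → ℝ) :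
    2 * ∑ i, x i * (x (σ i) - x i) = - ∑ i, (x (σ i) - x i) ^ 2 := by
  have h := Equiv.sum_comp σ (fun i => x i ^ 2)
  rw [Finset.mul_sum, ← sub_eq_zero, sub_neg_eq_add, ← Finset.sum_add_distrib, ← sub_eq_zero.2 h,
    ← Finset.sum_sub_distrib]
  exact Finset.sum_congr rfl fun i _ => by ring

/-- The Poincaré inequality on a cycle. -/
lemma exists_sum_sq_le_cycle (σ : Equiv.Perm ι) (hσ : ∀ i j, ∃ k, σ^[k] i = j) {a : ι → ℝ}
    (ha : ∀ i, 0 < a i) :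
    ∃ C > 0, ∀ x : ι → ℝ, ∑ i, x i / a i = 0 →
      ∑ i, x i ^ 2 / a i ≤ C * ∑ i, (x (σ i) - x i) ^ 2 := by
  choose k hk using hσ
  set M : ℝ := ∑ i, ∑ j, (k i j : ℝ)
  set S : ℝ := ∑ i, 1 / a i
  have hS0 : 0 ≤ S := Finset.sum_nonneg fun i _ => (one_div_pos.2 (ha i)).le
  have hM0 : 0 ≤ M := by positivity
  have hkM : ∀ i j, (k i j : ℝ) ≤ M := fun i j =>
    (Finset.single_le_sum (f := fun j => (k i j : ℝ)) (fun _ _ => by positivity)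
      (Finset.mem_univ j)).trans (Finset.single_le_sum (f := fun i => ∑ j, (k i j : ℝ))
      (fun _ _ => by positivity) (Finset.mem_univ i))
  -- M bounds the number of steps between any two points of the cycle and S is the total weight. The
  -- summand 1 only makes the constant positive.
  refine ⟨M ^ 2 * S + 1, by positivity, fun x hx => ?_⟩
  set D := ∑ i, (x (σ i) - x i) ^ 2
  have hD0 : 0 ≤ D := Finset.sum_nonneg fun i _ => sq_nonneg _
  have hdiff : ∀ i j, |x j - x i| ≤ M * √D := fun i j => by
    have := abs_sub_iterate_le σ x i (k i j)
    rw [hk] at this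
    exact this.trans (mul_le_mul_of_nonneg_right (hkM i j) (Real.sqrt_nonneg _))
  have hx2 : ∀ i, x i ^ 2 ≤ M ^ 2 * D := by
    intro i
    have hSpos : 0 < S := Finset.sum_pos (fun i _ => one_div_pos.2 (ha i)) ⟨i, Finset.mem_univ _⟩
    -- As the weighted mean of x vanishes, S · x i is the weighted sum of the differences x i − x j,
    -- each of which is controlled along the cycle.
    have h1 : |x i| * S ≤ M * √D * S := by
      calc |x i| * S = |∑ j, (x i - x j) * (1 / a j)| := by
            rw [← abs_of_pos hSpos, ← abs_mul]
            congr 1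
            simp only [mul_one_div, sub_div, Finset.sum_sub_distrib, hx, sub_zero, S,
              Finset.mul_sum]
        _ ≤ ∑ j, |(x i - x j) * (1 / a j)| := Finset.abs_sum_le_sum_abs _ _
        _ ≤ ∑ j, M * √D * (1 / a j) := Finset.sum_le_sum fun j _ => by
            rw [abs_mul, abs_of_pos (one_div_pos.2 (ha j))]
            exact mul_le_mul_of_nonneg_right (hdiff j i) (one_div_pos.2 (ha j)).le
        _ = _ := by rw [Finset.mul_sum]
    have h2 := le_of_mul_le_mul_right h1 hSpos
    calc x i ^ 2 = |x i| ^ 2 := (sq_abs _).symm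
      _ ≤ (M * √D) ^ 2 := pow_le_pow_left₀ (abs_nonneg _) h2 2
      _ = _ := by rw [mul_pow, Real.sq_sqrt hD0]
  calc _ ≤ ∑ i, M ^ 2 * D * (1 / a i) := Finset.sum_le_sum fun i _ => by
        rw [div_eq_mul_one_div]
        exact mul_le_mul_of_nonneg_right (hx2 i) (one_div_pos.2 (ha i)).le
    _ = M ^ 2 * S * D := by rw [← Finset.mul_sum]; ring
    _ ≤ _ := by nlinarith

/-- Averaging along a cycle with step sizes of order `1 / n` equalizes the values. -/
lemma tendsto_of_cyclic_averaging [Nonempty ι] (σ : Equiv.Perm ι) (hσ : ∀ i j, ∃ k, σ^[k] i = j)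
    {a : ι → ℝ} (ha : ∀ i, 0 < a i) {t : ℕ → ℝ} (htop : Tendsto t atTop atTop)
    (ht : ∀ᶠ n in atTop, t n ≤ 2 * (n + 1)) {u : ℕ → ι → ℝ}
    (hu : ∀ᶠ n in atTop, ∀ i, u (n + 1) i = u n i + a i / t n * (u n (σ i) - u n i))
    (hone : ∀ᶠ n in atTop, ∑ i, u n i / a i = 1) (i : ι) :
    Tendsto (fun n => u n i) atTop (𝓝 (1 / ∑ i, 1 / a i)) := by
  obtain ⟨C, hC, hP⟩ := exists_sum_sq_le_cycle σ hσ ha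
  have hSpos : 0 < ∑ i, 1 / a i :=
    Finset.sum_pos (fun i _ => one_div_pos.2 (ha i)) Finset.univ_nonempty
  set c : ℝ := 1 / ∑ i, 1 / a i with hc
  -- The weighted squared distance to c is the Lyapunov function. With the weights 1 / a i, its
  -- first-order change is exactly minus the Dirichlet form D divided by t n.
  set e : ℕ → ℝ := fun n => ∑ i, (u n i - c) ^ 2 / a i
  have he0 : ∀ n, 0 ≤ e n := fun n =>
    Finset.sum_nonneg fun i _ => div_nonneg (sq_nonneg _) (ha i).le
  set A : ℝ := ∑ i, a i
  have haA : ∀ i, a i ≤ A := fun i =>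
    Finset.single_le_sum (f := a) (fun i _ => (ha i).le) (Finset.mem_univ i)
  have hApos : 0 < A := (ha i).trans_le (haA i)
  -- The bound t n ≥ 2A makes the quadratic error at most half of the first-order decrease. What is
  -- left, D / (2 t n), is at least e n / (2 C t n) by the Poincaré inequality.
  obtain ⟨n₀, hn₀⟩ := eventually_atTop.1
    ((ht.and (hu.and hone)).and (htop.eventually_ge_atTop (2 * A)))
  have hstep : ∀ n ≥ n₀, e (n + 1) ≤ e n * (1 - (1 / (2 * C)) / t n) := by
    intro n hn
    obtain ⟨⟨_, h2, h3⟩, h4⟩ := hn₀ n hn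
    have htn : 0 < t n := by linarith
    set x : ι → ℝ := fun i => u n i - c with hx
    set D := ∑ i, (x (σ i) - x i) ^ 2 with hD
    have hD0 : 0 ≤ D := Finset.sum_nonneg fun i _ => sq_nonneg _
    have hx0 : ∑ i, x i / a i = 0 := by
      simp only [hx, sub_div, Finset.sum_sub_distrib, h3]
      rw [sub_eq_zero, ← one_div_mul_cancel hSpos.ne', Finset.mul_sum]
      simp only [mul_one_div, ← hc]
    have hPx := hP x hx0
    have hexp : e (n + 1) = e n - D / t n + (∑ i, a i * (x (σ i) - x i) ^ 2) / t n ^ 2 := by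
      have hs := sum_mul_sub_perm σ x
      rw [← hD] at hs
      have : D = -(2 * ∑ i, x i * (x (σ i) - x i)) := by rw [hs, neg_neg]
      rw [this, neg_div, sub_neg_eq_add, Finset.mul_sum, Finset.sum_div, Finset.sum_div,
        ← Finset.sum_add_distrib, ← Finset.sum_add_distrib]
      refine Finset.sum_congr rfl fun i _ => ?_
      rw [h2 i]
      have := (ha i).ne'
      simp only [hx]
      field_simp
      ring
    have hA : (∑ i, a i * (x (σ i) - x i) ^ 2) ≤ A * D := by
      rw [hD, Finset.mul_sum]
      exact Finset.sum_le_sum fun i _ => mul_le_mul_of_nonneg_right (haA i) (sq_nonneg _)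
    have h5 : (∑ i, a i * (x (σ i) - x i) ^ 2) / t n ^ 2 ≤ D / t n / 2 := by
      rw [div_le_iff₀ (by positivity)]
      refine hA.trans ?_
      have : D / t n / 2 * t n ^ 2 = t n / 2 * D := by field_simp
      rw [this]
      exact mul_le_mul_of_nonneg_right (by linarith) hD0
    have h6 : e n / C ≤ D := by rw [div_le_iff₀ hC, mul_comm]; exact hPx
    have h7 : e n / C / t n ≤ D / t n := div_le_div_of_nonneg_right h6 htn.le
    have h8 : e n * (1 - 1 / (2 * C) / t n) = e n - e n / C / t n / 2 := by field_simp
    rw [h8, hexp]; linarith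
  have hlim := tendsto_zero_of_le_mul_one_sub_div (by positivity) he0
    (fun n hn => ⟨by linarith [(hn₀ n hn).2], (hn₀ n hn).1.1⟩) hstep
  rw [tendsto_iff_norm_sub_tendsto_zero]
  have h9 : Tendsto (fun n => √(a i * e n)) atTop (𝓝 0) := by
    have := (hlim.const_mul (a i)).sqrt
    simpa using this
  refine squeeze_zero (fun n => norm_nonneg _) (fun n => ?_) h9
  rw [Real.norm_eq_abs]
  refine Real.abs_le_sqrt ?_
  have := Finset.single_le_sum (f := fun i => (u n i - c) ^ 2 / a i)
    (fun i _ => div_nonneg (sq_nonneg _) (ha i).le) (Finset.mem_univ i)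
  rw [mul_comm, ← div_le_iff₀ (ha i)]
  exact this

end CyclicAveraging

/-! ### Counting the buckets of a given capacity -/

namespace BucketTree

lemma cap_eq_zero {F : BucketFamily} {b : ℕ} {T : BucketTree} (hV : T.Valid F b) {u : ℕ}
    (hu : T.size < u) : T.cap u = 0 := by
  unfold cap
  rw [Finset.card_eq_zero, Finset.filter_eq_empty_iff]
  rintro i hi rfl
  have := mem_nodes.1 (hV.node_mem i hi)
  omega

lemma cap_last_insert_of_lt {b : ℕ} {T : BucketTree} {v : ℕ} (h : T.cap v < b) :
    (T.insert b v).cap ((T.insert b v).node (T.size + 1)) = T.cap v + 1 := by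
  rw [insert_node_last_of_lt h, cap_insert_self_of_lt h]

lemma cap_last_insert_of_le {F : BucketFamily} {b : ℕ} {T : BucketTree} (hV : T.Valid F b) {v : ℕ}
    (h : b ≤ T.cap v) : (T.insert b v).cap ((T.insert b v).node (T.size + 1)) = 1 := by
  rw [cap_insert, if_pos rfl, insert_node_last_of_le h, cap_eq_zero hV (by omega)]

/-- The number of nodes of capacity `m`. -/
def numNodes (T : BucketTree) (m : ℕ) : ℕ :=
  ∑ v ∈ T.nodes, if T.cap v = m then 1 else 0

lemma numNodes_le (T : BucketTree) (m : ℕ) : T.numNodes m ≤ T.size := by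
  unfold numNodes
  rw [← Finset.card_filter]
  refine (Finset.card_filter_le _ _).trans ((Finset.card_filter_le _ _).trans ?_)
  simp

/-- Only the bucket that receives the new label matters: if it ends with capacity c, one bucket of
capacity c is gained and, for c > 1, one of capacity c − 1 is lost. The assumption 1 ≤ m leaves out
the fictitious loss of an empty bucket when a new one is opened. -/
lemma numNodes_insert {F : BucketFamily} {b : ℕ} {T : BucketTree} (hV : T.Valid F b) {v : ℕ}
    (hv : v ∈ T.nodes) {m : ℕ} (hm : 1 ≤ m) :
    (T.insert b v).numNodes m +
        (if (T.insert b v).cap ((T.insert b v).node (T.size + 1)) = m + 1 then 1 else 0) =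
      T.numNodes m +
        if (T.insert b v).cap ((T.insert b v).node (T.size + 1)) = m then 1 else 0 := by
  unfold numNodes
  rcases Nat.lt_or_ge (T.cap v) b with hc | hc
  · rw [nodes_insert_of_lt hv hc, cap_last_insert_of_lt hc, ← Finset.add_sum_erase _ _ hv,
      ← Finset.add_sum_erase T.nodes (fun u => if T.cap u = m then 1 else 0) hv,
      cap_insert_self_of_lt hc]
    have : ∑ u ∈ T.nodes.erase v, (if (T.insert b v).cap u = m then 1 else 0)
        = ∑ u ∈ T.nodes.erase v, if T.cap u = m then 1 else 0 :=
      Finset.sum_congr rfl fun u hu => by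
        rw [cap_insert_of_ne (Finset.mem_erase.1 hu).2 (Finset.mem_erase.1 hu).1]
    rw [this]
    simp only [add_left_inj]
    ring
  · have : ∑ u ∈ T.nodes, (if (T.insert b v).cap u = m then 1 else 0)
        = ∑ u ∈ T.nodes, if T.cap u = m then 1 else 0 :=
      Finset.sum_congr rfl fun u hu => by rw [cap_insert_of_le hu hc]
    rw [nodes_insert_of_le hc, Finset.sum_insert T.size_succ_notMem_nodes, this,
      cap_last_insert_of_le hV hc]
    have hlast := cap_last_insert_of_le hV hc
    rw [insert_node_last_of_le hc] at hlast
    rw [hlast, if_neg (show 1 ≠ m + 1 by omega)]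
    ring

lemma Increasing.outdeg_eq_zero {F : BucketFamily} {b : ℕ} {T : BucketTree} (hV : T.Valid F b)
    (h : T.Increasing b) {v : ℕ} (hv : v ∈ T.nodes) (hc : T.cap v < b) : T.outdeg v = 0 := by
  unfold outdeg
  rw [Finset.card_eq_zero, Finset.filter_eq_empty_iff]
  rintro u hu rfl
  have hu1 : u ≠ 1 := by
    rintro rfl
    have := mem_nodes.1 hv
    rw [hV.root_parent] at this; omega
  have := h.cap_parent u hu hu1
  omega

end BucketTree

/-! ### The limit law of the initial bucket size -/

namespace BucketFamily

/-- Only saturated buckets have children, so the out-degree disappears from the formula. This is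
what makes the recursion for the initial sizes close up. -/
lemma attractProb_of_unsaturated (F : BucketFamily) {b : ℕ} {T : BucketTree} (hV : T.Valid F b)
    (h : T.Increasing b) {v : ℕ} (hv : v ∈ T.nodes) (hc : T.cap v < b) :
    F.attractProb T.size (T.cap v) (T.outdeg v) = (T.cap v + F.kappa) / (T.size + F.kappa) := by
  rw [F.attractProb_eq hV.size_pos, h.outdeg_eq_zero hV hv hc]
  simp

/-- The probability `P(K_n = m)`. -/
noncomputable def initialSizeProb (F : BucketFamily) (b n m : ℕ) : ℝ :=
  (F.treeLaw b n).real {T | T.cap (T.node n) = m}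

/-- The expected number of nodes of capacity `m`. -/
noncomputable def meanNumNodes (F : BucketFamily) (b n m : ℕ) : ENNReal :=
  ∫⁻ T, (T.numNodes m : ENNReal) ∂(F.treeLaw b n)

lemma meanNumNodes_ne_top (F : BucketFamily) (b m : ℕ) {n : ℕ} (hn : 1 ≤ n) :
    F.meanNumNodes b n m ≠ ⊤ := by
  have : F.meanNumNodes b n m ≤ ∫⁻ _, (n : ENNReal) ∂(F.treeLaw b n) := by
    refine lintegral_mono_ae ?_
    filter_upwards [F.ae_treeLaw b hn] with T hT
    exact_mod_cast (T.numNodes_le m).trans hT.2.2.le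
  rw [lintegral_const, measure_univ, mul_one] at this
  exact ne_top_of_le_ne_top (ENNReal.natCast_ne_top n) this

lemma treeLaw_cap_eq_lintegral (F : BucketFamily) (b n m : ℕ) :
    F.treeLaw b n {T | T.cap (T.node n) = m} =
      ∫⁻ T, ((if T.cap (T.node n) = m then 1 else 0 : ℕ) : ENNReal) ∂(F.treeLaw b n) := by
  rw [← lintegral_indicator_one (measurableSet_bucketTree _)]
  refine lintegral_congr fun T => ?_
  simp [Set.indicator_apply]

/-- The label n + 1 sees initial size m + 1 ≥ 2 exactly when one of the unsaturated buckets of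
capacity m attracts it, and each of them does so with the same probability. -/
lemma initialSizeProb_succ_succ (F : BucketFamily) (b : ℕ) {n m : ℕ} (hn : 1 ≤ n) (hm : 1 ≤ m)
    (hmb : m < b) :
    F.initialSizeProb b (n + 1) (m + 1) =
      (m + F.kappa) / (n + F.kappa) * (F.meanNumNodes b n m).toReal := by
  have hpos : 0 ≤ (m + F.kappa) / (n + F.kappa) :=
    div_nonneg (F.add_kappa_pos hm).le (F.add_kappa_pos hn).le
  rw [← ENNReal.toReal_ofReal hpos, ← ENNReal.toReal_mul]
  unfold initialSizeProb Measure.real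
  congr 1
  rw [treeLaw_cap_eq_lintegral, F.lintegral_treeLaw_succ b hn, meanNumNodes,
    ← lintegral_const_mul _ (measurable_of_bucketTree _)]
  refine lintegral_congr_ae ?_
  filter_upwards [F.ae_treeLaw b hn] with T ⟨hV, hI, hs⟩
  subst hs
  rw [BucketTree.numNodes, Nat.cast_sum, Finset.mul_sum]
  refine Finset.sum_congr rfl fun v hv => ?_
  rcases Nat.lt_or_ge (T.cap v) b with hc | hc
  · rw [BucketTree.cap_last_insert_of_lt hc, F.attractProb_of_unsaturated hV hI hv hc]
    by_cases h : T.cap v = m <;> simp [h]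
  · rw [BucketTree.cap_last_insert_of_le hV hc, if_neg (by omega), if_neg (by omega)]
    simp

lemma meanNumNodes_succ (F : BucketFamily) (b : ℕ) {n m : ℕ} (hn : 1 ≤ n) (hm : 1 ≤ m) :
    (F.meanNumNodes b (n + 1) m).toReal + F.initialSizeProb b (n + 1) (m + 1) =
      (F.meanNumNodes b n m).toReal + F.initialSizeProb b (n + 1) m := by
  unfold initialSizeProb Measure.real
  rw [← ENNReal.toReal_add (F.meanNumNodes_ne_top b m (by omega)) (measure_ne_top _ _),
    ← ENNReal.toReal_add (F.meanNumNodes_ne_top b m hn) (measure_ne_top _ _)]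
  congr 1
  rw [treeLaw_cap_eq_lintegral, treeLaw_cap_eq_lintegral, meanNumNodes, meanNumNodes,
    ← lintegral_add_left (measurable_of_bucketTree _), F.lintegral_treeLaw_succ b hn,
    F.lintegral_treeLaw_succ b hn, ← lintegral_add_left (measurable_of_bucketTree _)]
  refine lintegral_congr_ae ?_
  filter_upwards [F.ae_treeLaw b hn] with T ⟨hV, hI, hs⟩
  subst hs
  rw [← one_mul ((T.numNodes m : ENNReal)), ← F.sum_ofReal_attractProb hV, Finset.sum_mul,
    ← Finset.sum_add_distrib]
  refine Finset.sum_congr rfl fun v hv => ?_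
  rw [← mul_add]
  congr 1
  exact_mod_cast BucketTree.numNodes_insert hV hv hm

lemma initialSizeProb_nonneg (F : BucketFamily) (b n m : ℕ) : 0 ≤ F.initialSizeProb b n m :=
  measureReal_nonneg

lemma sum_initialSizeProb (F : BucketFamily) {b n : ℕ} (hb : 1 ≤ b) (hn : 1 ≤ n) :
    ∑ l ∈ Finset.Icc 1 b, F.initialSizeProb b n l = 1 := by
  have := congrArg ENNReal.toReal (F.sum_treeLaw_cap_node hb hn)
  rwa [ENNReal.toReal_sum (fun _ _ => measure_ne_top _ _), ENNReal.toReal_one] at this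

/-- The mean number of buckets of capacity m is eliminated: it is proportional to P(K = m+1) one
step later, and its increment is P(K = m) − P(K = m+1). Two consecutive sizes are compared, whence 2
≤ n. -/
lemma initialSizeProb_recurrence (F : BucketFamily) (b : ℕ) {n m : ℕ} (hn : 2 ≤ n) (hm : 1 ≤ m)
    (hmb : m < b) :
    (n + F.kappa) * (F.initialSizeProb b (n + 1) (m + 1) - F.initialSizeProb b n (m + 1)) =
      (m + F.kappa) * F.initialSizeProb b n m -
        (m + 1 + F.kappa) * F.initialSizeProb b n (m + 1) := by
  obtain ⟨k, rfl⟩ := Nat.exists_eq_add_of_le' (show 1 ≤ n by omega)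
  have h1 := F.initialSizeProb_succ_succ b (n := k + 1) (by omega) hm hmb
  have h2 := F.initialSizeProb_succ_succ b (n := k) (by omega) hm hmb
  have h3 := F.meanNumNodes_succ b (n := k) (by omega) hm
  have p1 : 0 < ((k + 1 : ℕ) : ℝ) + F.kappa := F.add_kappa_pos (by omega)
  have p2 : 0 < (k : ℝ) + F.kappa := F.add_kappa_pos (by omega)
  rw [div_mul_eq_mul_div, eq_div_iff p1.ne'] at h1
  rw [div_mul_eq_mul_div, eq_div_iff p2.ne'] at h2
  push_cast at h1 ⊢
  linear_combination h1 - h2 + (m + F.kappa) * h3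

lemma sum_Icc_one_eq_sum_fin (b : ℕ) (f : ℕ → ℝ) :
    ∑ m ∈ Finset.Icc 1 b, f m = ∑ i : Fin b, f (i + 1) := by
  rw [Fin.sum_univ_eq_sum_range (fun i => f (i + 1)), Finset.range_eq_Ico,
    Finset.sum_Ico_add' f 0 b 1]
  rfl

open Fin.NatCast Fin.CommRing in
/-- The initial bucket sizes converge. -/
lemma tendsto_initialSizeProb (F : BucketFamily) {b m : ℕ} (hm : 1 ≤ m) (hmb : m ≤ b) :
    Tendsto (fun n => F.initialSizeProb b n m) atTop (𝓝 (F.limitSizeWeight b m)) := by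
  have hb : 1 ≤ b := hm.trans hmb
  have : NeZero b := ⟨by omega⟩
  set a : Fin b → ℝ := fun i => ((i + 1 : ℕ) : ℝ) + F.kappa with ha_def
  have ha : ∀ i, 0 < a i := fun i => F.add_kappa_pos (by omega)
  -- The index i stands for size i + 1, and σ passes to the preceding size, cyclically. Multiplying
  -- the probabilities by i + 1 + κ turns the recursion into an averaging along σ.
  set σ : Equiv.Perm (Fin b) := Equiv.subRight 1 with hσ_def
  set u : ℕ → Fin b → ℝ := fun n i => a i * F.initialSizeProb b n (i + 1) with hu_def
  have hua : ∀ n i, u n i / a i = F.initialSizeProb b n (i + 1) := fun n i =>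
    mul_div_cancel_left₀ _ (ha i).ne'
  have hone : ∀ n, 1 ≤ n → ∑ i, u n i / a i = 1 := by
    intro n hn
    simp only [hua]
    rw [← F.sum_initialSizeProb hb hn, sum_Icc_one_eq_sum_fin]
  have hσ : ∀ i j, ∃ k, σ^[k] i = j := by
    intro i j
    have h : ∀ k : ℕ, σ^[k] i = i - (k : Fin b) := by
      intro k
      induction k with
      | zero => simp
      | succ k ih =>
        rw [Function.iterate_succ_apply', ih, hσ_def, Equiv.subRight_apply]
        rw [Nat.cast_succ, sub_sub]
    refine ⟨(i - j).val, ?_⟩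
    rw [h, Fin.cast_val_eq_self, sub_sub_cancel]
  have hrec : ∀ n ≥ 2, ∀ i, u (n + 1) i = u n i + a i / (n + F.kappa) * (u n (σ i) - u n i) := by
    intro n hn
    have hpos : 0 < (n : ℝ) + F.kappa := F.add_kappa_pos (by omega)
    have hdiff : ∀ i : Fin b, i ≠ 0 → F.initialSizeProb b (n + 1) (i + 1) - F.initialSizeProb b n (i + 1) =
        (u n (σ i) - u n i) / (n + F.kappa) := by
      intro i hi
      have hi1 : 1 ≤ i.val := Nat.one_le_iff_ne_zero.2 fun h => hi (Fin.ext (by simpa using h))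
      have hv : (σ i).val + 1 = i.val := by
        rw [hσ_def, Equiv.subRight_apply, Fin.val_sub_one_of_ne_zero hi]; omega
      have h := F.initialSizeProb_recurrence b (m := i.val) hn hi1 i.isLt
      rw [eq_div_iff hpos.ne', mul_comm, h]
      simp only [hu_def, ha_def, hv]
      push_cast; ring
    have hdiff' : ∀ i : Fin b, F.initialSizeProb b (n + 1) (i + 1) - F.initialSizeProb b n (i + 1) =
        (u n (σ i) - u n i) / (n + F.kappa) := by
      intro i
      -- For size 1 the recursion says nothing, since new buckets arise from saturated nodes with
      -- arbitrary out-degree. But the increments over all sizes add up to 0, and so do the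
      -- right-hand sides over the cycle; the identity for size 1 is what remains.
      by_cases hi : i = 0
      · subst hi
        have h1 := hone (n + 1) (by omega)
        have h2 := hone n (by omega)
        simp only [hua] at h1 h2
        have h3 : ∑ i : Fin b, (F.initialSizeProb b (n + 1) (i + 1) - F.initialSizeProb b n (i + 1))
            = ∑ i, (u n (σ i) - u n i) / (n + F.kappa) := by
          rw [Finset.sum_sub_distrib, h1, h2, ← Finset.sum_div, Finset.sum_sub_distrib,
            Equiv.sum_comp σ (u n)]
          simp
        rw [← Finset.add_sum_erase _ _ (Finset.mem_univ (0 : Fin b)),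
          ← Finset.add_sum_erase (Finset.univ) (fun i => (u n (σ i) - u n i) / (n + F.kappa))
          (Finset.mem_univ (0 : Fin b)),
          Finset.sum_congr rfl (fun i hi => hdiff i (Finset.mem_erase.1 hi).1)] at h3
        exact add_right_cancel h3
      · exact hdiff i hi
    intro i
    have := hdiff' i
    simp only [hu_def] at this ⊢
    linear_combination a i * this
  have htop : Tendsto (fun n : ℕ => (n : ℝ) + F.kappa) atTop atTop :=
    tendsto_atTop_add_const_right _ _ tendsto_natCast_atTop_atTop
  have ht : ∀ᶠ n : ℕ in atTop, (n : ℝ) + F.kappa ≤ 2 * (n + 1) := by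
    filter_upwards [tendsto_natCast_atTop_atTop.eventually_ge_atTop F.kappa] with n hn
    linarith
  have key := tendsto_of_cyclic_averaging σ hσ ha htop ht (u := u)
    (eventually_atTop.2 ⟨2, hrec⟩) (eventually_atTop.2 ⟨1, hone⟩) ⟨m - 1, by omega⟩
  have hm' : m - 1 + 1 = m := by omega
  have := key.div_const (a ⟨m - 1, by omega⟩)
  simp only [hua, hm'] at this
  convert this using 2
  unfold limitSizeWeight
  rw [sum_Icc_one_eq_sum_fin b (fun k => 1 / ((k : ℝ) + F.kappa))]
  simp only [ha_def, hm']
  rw [div_div, mul_comm]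

end BucketFamily

/-! ### Asymptotics of Gamma quotients -/

lemma prod_add_eq_Gamma_div {r : ℝ} (hr : 0 < r) (m : ℕ) :
    ∏ i ∈ Finset.range m, (r + i) = Real.Gamma (r + m) / Real.Gamma r := by
  induction m with
  | zero => simp [(Real.Gamma_pos_of_pos hr).ne']
  | succ m ih =>
    rw [Finset.prod_range_succ, ih, Nat.cast_succ, ← add_assoc,
      Real.Gamma_add_one (by positivity)]
    ring

/-- This is Euler's limit formula for Γ(r). The product in `Real.GammaSeq` has n + 1 factors, and
the extra one is compensated by n / (n + r). -/
lemma tendsto_Gamma_add_div {r : ℝ} (hr : 0 < r) :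
    Tendsto (fun n : ℕ => Real.Gamma (r + n) / (Real.Gamma n * (n : ℝ) ^ r)) atTop (𝓝 1) := by
  have hG := Real.Gamma_pos_of_pos hr
  have h1 := (tendsto_const_nhds (x := Real.Gamma r)).div (Real.GammaSeq_tendsto_Gamma r) hG.ne'
  rw [div_self hG.ne'] at h1
  have h2 : Tendsto (fun n : ℕ => (n : ℝ) / (n + r)) atTop (𝓝 1) :=
    tendsto_natCast_div_add_atTop r
  have h3 := h1.mul h2
  rw [one_mul] at h3
  refine h3.congr' ?_
  filter_upwards [eventually_gt_atTop 0] with n hn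
  have hn' : (0 : ℝ) < n := by exact_mod_cast hn
  have hrn : 0 < Real.Gamma (r + n) := Real.Gamma_pos_of_pos (by positivity)
  have hf : (n.factorial : ℝ) = n * Real.Gamma n := by
    rw [← Real.Gamma_nat_eq_factorial, Real.Gamma_add_one hn'.ne']
  have hn0 := Real.Gamma_pos_of_pos hn'
  have hp : 0 < (n : ℝ) ^ r := Real.rpow_pos_of_pos hn' r
  rw [Pi.div_apply, Real.GammaSeq, prod_add_eq_Gamma_div hr, hf, Nat.cast_succ, ← add_assoc,
    Real.Gamma_add_one (by positivity)]
  field_simp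
  ring

lemma tendsto_Gamma_ratio {r : ℝ} (hr : 0 < r) (l : ℕ) :
    Tendsto (fun n : ℕ => (n : ℝ) ^ r * (Real.Gamma (n - l) / Real.Gamma (r + (n - l))))
      atTop (𝓝 1) := by
  have h1 := ((tendsto_Gamma_add_div hr).inv₀ one_ne_zero).comp (tendsto_sub_atTop_nat l)
  have h2 : Tendsto (fun n : ℕ => ((n : ℝ) / (n - l)) ^ r) atTop (𝓝 1) := by
    have := (tendsto_natCast_div_add_atTop (-(l : ℝ))).rpow_const (p := r) (Or.inl one_ne_zero)
    simpa [← sub_eq_add_neg] using this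
  have h3 := h1.mul h2
  simp only [inv_one, mul_one] at h3
  refine h3.congr' ?_
  filter_upwards [eventually_gt_atTop l] with n hn
  have hn' : (0 : ℝ) < n - l := by
    have : (l : ℝ) < n := by exact_mod_cast hn
    linarith
  have hp : 0 < ((n : ℝ) - l) ^ r := Real.rpow_pos_of_pos hn' r
  simp only [Function.comp, Nat.cast_sub hn.le, inv_div]
  rw [Real.div_rpow (by positivity) hn'.le]
  field_simp

/-- The normalizing factor of the Pólya weights. -/
lemma prod_div_eq_Gamma {r : ℝ} (hr : 0 < r) {j l n : ℕ} (hl : l < j) (hn : j ≤ n) :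
    ∏ i ∈ Finset.range (n - j), ((j : ℝ) - l + i) / (r + (j - l) + i) =
      Real.Gamma (n - l) / Real.Gamma (r + (n - l)) /
        (Real.Gamma (j - l) / Real.Gamma (r + (j - l))) := by
  have hs : (0 : ℝ) < j - l := by
    have : (l : ℝ) < j := by exact_mod_cast hl
    linarith
  rw [Finset.prod_div_distrib, prod_add_eq_Gamma_div hs, prod_add_eq_Gamma_div (by positivity),
    Nat.cast_sub hn]
  rw [show (j : ℝ) - l + (n - j) = n - l by ring, show r + (j - l) + ((n : ℝ) - j) = r + (n - l) by ring]
  rw [div_div_div_eq, div_div_div_eq]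
  ring

lemma prod_div_add_one_nonneg {r : ℝ} (hr : 0 < r) (m : ℕ) :
    0 ≤ ∏ i ∈ Finset.range m, (r + i) / ((i : ℝ) + 1) :=
  Finset.prod_nonneg fun i _ => by positivity

/-- The source of the factor x^(r−1) / Γ(r) in both the beta and the gamma density. -/
lemma tendsto_prod_div_add_one {r : ℝ} (hr : 0 < r) :
    Tendsto (fun m : ℕ => (∏ i ∈ Finset.range m, (r + i) / ((i : ℝ) + 1)) / (m : ℝ) ^ (r - 1)) atTop
      (𝓝 (1 / Real.Gamma r)) := by
  refine ((tendsto_Gamma_add_div hr).div_const (Real.Gamma r)).congr' ?_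
  filter_upwards [eventually_gt_atTop 0] with m hm
  have hm' : (0 : ℝ) < m := by exact_mod_cast hm
  have hf : ∏ i ∈ Finset.range m, ((i : ℝ) + 1) = m * Real.Gamma m := by
    rw [← Real.Gamma_add_one hm'.ne', Real.Gamma_nat_eq_factorial,
      ← Finset.prod_range_add_one_eq_factorial]
    push_cast; rfl
  rw [Finset.prod_div_distrib, prod_add_eq_Gamma_div hr, hf, Real.rpow_sub_one hm'.ne']
  field_simp

lemma tendsto_floor_mul_div {c : ℕ → ℝ} (hc : Tendsto c atTop atTop) {x : ℝ} (hx : 0 ≤ x) :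
    Tendsto (fun n => (⌊x * c n⌋₊ : ℝ) / c n) atTop (𝓝 x) :=
  (tendsto_nat_floor_mul_div_atTop hx).comp hc

lemma tendsto_floor_mul {c : ℕ → ℝ} (hc : Tendsto c atTop atTop) {x : ℝ} (hx : 0 < x) :
    Tendsto (fun n => ⌊x * c n⌋₊) atTop atTop :=
  tendsto_nat_floor_atTop.comp (hc.const_mul_atTop hx)

lemma tendsto_prod_div_add_one_floor {r : ℝ} (hr : 0 < r) {c : ℕ → ℝ} (hc : Tendsto c atTop atTop)
    {x : ℝ} (hx : 0 < x) :
    Tendsto (fun n => (∏ i ∈ Finset.range ⌊x * c n⌋₊, (r + i) / ((i : ℝ) + 1)) / c n ^ (r - 1)) atTop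
      (𝓝 (1 / Real.Gamma r * x ^ (r - 1))) := by
  refine (((tendsto_prod_div_add_one hr).comp (tendsto_floor_mul hc hx)).mul
    ((tendsto_floor_mul_div hc hx.le).rpow_const (p := r - 1) (Or.inl hx.ne'))).congr' ?_
  filter_upwards [hc.eventually_gt_atTop 0, (tendsto_floor_mul hc hx).eventually_gt_atTop 0]
    with n h1 h2
  have h2' : (0 : ℝ) < (⌊x * c n⌋₊ : ℝ) := by exact_mod_cast h2
  have := Real.rpow_pos_of_pos h2' (r - 1)
  rw [Real.div_rpow h2'.le h1.le]
  simp only [Function.comp]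
  field_simp

/-! ### Limits of the Pólya weights -/

/-- Exchange of the two products in a quotient of falling factorials. -/
lemma prod_sub_div_swap (A : ℝ) (k m : ℕ) (hm : (m : ℝ) ≤ A) (hk : (k : ℝ) ≤ A) :
    ∏ i ∈ Finset.range m, (A - k - i) / (A - i) = ∏ i ∈ Finset.range k, (A - m - i) / (A - i) := by
  induction m with
  | zero =>
    rw [Finset.range_zero, Finset.prod_empty, Finset.prod_eq_one]
    intro i hi
    have : ((i + 1 : ℕ) : ℝ) ≤ k := by exact_mod_cast Finset.mem_range.1 hi
    push_cast at this ⊢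
    rw [sub_zero, div_self]; linarith
  | succ m ih =>
    push_cast at hm
    rw [Finset.prod_range_succ, ih (by linarith), Finset.prod_div_distrib, Finset.prod_div_distrib,
      div_mul_div_comm, mul_comm (∏ i ∈ Finset.range k, (A - i)), ← div_div]
    congr 1
    rw [div_eq_iff (by linarith)]
    -- The same product of k + 1 factors is peeled once at its end and once at its beginning.
    have h1 := Finset.prod_range_succ (fun i : ℕ => A - m - i) k
    have h2 := Finset.prod_range_succ' (fun i : ℕ => A - m - i) k
    rw [h1] at h2
    rw [show A - k - m = A - m - k by ring, h2, Nat.cast_zero, sub_zero]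
    congr 1
    exact Finset.prod_congr rfl fun i _ => by push_cast; ring

lemma polyaWeight_eq {r : ℝ} (hr : 0 < r) {j l n : ℕ} (hl : l < j) (hn : j ≤ n) (m : ℕ) :
    polyaWeight r (j - l) (n - j) m = (∏ i ∈ Finset.range m, (r + i) / ((i : ℝ) + 1)) *
      (Real.Gamma (n - l) / Real.Gamma (r + (n - l)) /
        (Real.Gamma (j - l) / Real.Gamma (r + (j - l)))) *
      ∏ i ∈ Finset.range m, ((n : ℝ) - j - i) / (n - l - 1 - i) := by
  rw [polyaWeight, prod_div_eq_Gamma hr hl hn]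
  congr 1
  refine Finset.prod_congr rfl fun i _ => ?_
  rw [Nat.cast_sub hn]
  congr 1
  ring

/-- Beta limit of the Pólya weights. -/
lemma tendsto_polyaWeight_beta {r : ℝ} (hr : 0 < r) {j l : ℕ} (hl : l < j) {x : ℝ} (hx : 0 < x)
    (hx1 : x < 1) :
    Tendsto (fun n : ℕ => (n : ℝ) * polyaWeight r (j - l) (n - j) ⌊x * n⌋₊) atTop
      (𝓝 (betaPDFReal r (j - l) x)) := by
  have hs : (0 : ℝ) < j - l := by
    have : (l : ℝ) < j := by exact_mod_cast hl
    linarith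
  have hc : Tendsto (fun n : ℕ => (n : ℝ)) atTop atTop := tendsto_natCast_atTop_atTop
  -- The beta exponent j − l − 1 is a natural number k. Exchanging the products therefore replaces a
  -- product of ⌊x n⌋ factors by one of k factors, each tending to 1 − x.
  obtain ⟨k, rfl⟩ : ∃ k, j = l + 1 + k := ⟨j - (l + 1), by omega⟩
  have hQ : Tendsto (fun n : ℕ => ∏ i ∈ Finset.range ⌊x * n⌋₊,
      ((n : ℝ) - (l + 1 + k : ℕ) - i) / (n - l - 1 - i)) atTop (𝓝 ((1 - x) ^ k)) := by
    have hfac : ∀ i ∈ Finset.range k, Tendsto (fun n : ℕ =>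
        ((n : ℝ) - l - 1 - ⌊x * n⌋₊ - i) / (n - l - 1 - i)) atTop (𝓝 (1 - x)) := by
      intro i _
      have h1 : Tendsto (fun n : ℕ => 1 - (⌊x * n⌋₊ : ℝ) / n * ((n : ℝ) / (n + (-(l + 1 + i)))))
          atTop (𝓝 (1 - x * 1)) :=
        ((tendsto_floor_mul_div hc hx.le).mul (tendsto_natCast_div_add_atTop _)).const_sub 1
      rw [mul_one] at h1
      refine h1.congr' ?_
      filter_upwards [eventually_gt_atTop (l + 1 + i)] with n hn
      have hn' : (l : ℝ) + 1 + i < n := by exact_mod_cast hn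
      have h2 : (0 : ℝ) < n := lt_of_le_of_lt (by positivity) hn'
      have h3 : (n : ℝ) - l - 1 - i ≠ 0 := by linarith
      rw [show (n : ℝ) + (-(l + 1 + i)) = n - l - 1 - i by ring]
      field_simp
      ring
    have hP := tendsto_finsetProd (Finset.range k) hfac
    rw [Finset.prod_const, Finset.card_range] at hP
    refine hP.congr' ?_
    have hlt : ∀ᶠ n : ℕ in atTop, (⌊x * n⌋₊ : ℝ) ≤ n - l - 1 := by
      filter_upwards [(hc.const_mul_atTop (sub_pos.2 hx1)).eventually_ge_atTop ((l : ℝ) + 1)] with n hn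
      have := Nat.floor_le (show 0 ≤ x * (n : ℝ) by positivity)
      linarith
    filter_upwards [hlt, hc.eventually_ge_atTop ((l : ℝ) + 1 + k)] with n h1 h2
    rw [← prod_sub_div_swap ((n : ℝ) - l - 1) k _ h1 (by linarith)]
    refine Finset.prod_congr rfl fun i _ => ?_
    push_cast
    congr 1; ring
  have h := (((tendsto_prod_div_add_one_floor hr hc hx).mul (tendsto_Gamma_ratio hr l)).div_const
    (Real.Gamma ((l + 1 + k : ℕ) - l) / Real.Gamma (r + ((l + 1 + k : ℕ) - l)))).mul hQ
  have hlim : 1 / Real.Gamma r * x ^ (r - 1) * 1 /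
      (Real.Gamma (((l + 1 + k : ℕ) : ℝ) - l) / Real.Gamma (r + (((l + 1 + k : ℕ) : ℝ) - l))) *
        (1 - x) ^ k = betaPDFReal r ((l + 1 + k : ℕ) - l) x := by
    rw [betaPDFReal, if_pos ⟨hx, hx1⟩, beta,
      show ((l + 1 + k : ℕ) : ℝ) - l - 1 = k by push_cast; ring, Real.rpow_natCast]
    have := Real.Gamma_pos_of_pos hr
    have := Real.Gamma_pos_of_pos hs
    field_simp
  rw [hlim] at h
  refine h.congr' ?_
  filter_upwards [eventually_ge_atTop (l + 1 + k)] with n hn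
  have hn0 : (0 : ℝ) < n := by
    have : 0 < n := by omega
    exact_mod_cast this
  have hp := Real.rpow_pos_of_pos hn0 r
  rw [polyaWeight_eq hr hl hn, Real.rpow_sub_one hn0.ne']
  field_simp

/-- The normalizing factor is a quotient of Gamma ratios at n and at j n, which behave like n^(−r)
and (j n)^(−r). -/
lemma tendsto_rpow_mul_Gamma_ratio {r : ℝ} (hr : 0 < r) (l : ℕ) {j : ℕ → ℕ}
    (hj : Tendsto j atTop atTop) :
    Tendsto (fun n : ℕ => ((n : ℝ) / j n) ^ r * (Real.Gamma (n - l) / Real.Gamma (r + (n - l)) /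
        (Real.Gamma (j n - l) / Real.Gamma (r + (j n - l))))) atTop (𝓝 1) := by
  have h := (tendsto_Gamma_ratio hr l).div ((tendsto_Gamma_ratio hr l).comp hj) one_ne_zero
  rw [div_one] at h
  refine h.congr fun n => ?_
  simp only [Function.comp, Pi.div_apply]
  rw [Real.div_rpow (by positivity) (by positivity)]
  simp only [div_eq_mul_inv, mul_inv]
  ring

/-- The reciprocal of each factor is 1 + (j − l − 1)/(n − j − i) ≤ exp(j/(n − j − m)). A one-sided
bound is all that the later Fatou argument requires. -/
lemma exp_le_prod_sub_div {n j l m : ℕ} (hl : l < j) (hm : j + m < n) :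
    Real.exp (-(m * ((j : ℝ) / (n - j - m)))) ≤
      ∏ i ∈ Finset.range m, ((n : ℝ) - j - i) / (n - l - 1 - i) := by
  have hm' : (j : ℝ) + m < n := by exact_mod_cast hm
  have hl' : (l : ℝ) + 1 ≤ j := by exact_mod_cast hl
  have hl0 : (0 : ℝ) ≤ l := by positivity
  rw [← mul_neg, Real.exp_nat_mul, ← Finset.card_range m, ← Finset.prod_const, Finset.card_range]
  refine Finset.prod_le_prod (fun _ _ => (Real.exp_pos _).le) fun i hi => ?_
  have hi' : (i : ℝ) < m := by exact_mod_cast Finset.mem_range.1 hi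
  rw [Real.exp_neg, ← inv_div ((n : ℝ) - l - 1 - i)]
  refine inv_anti₀ (div_pos (by linarith) (by linarith)) ?_
  refine le_trans ?_ (Real.add_one_le_exp _)
  rw [div_le_iff₀ (by linarith), add_mul, one_mul, div_mul_eq_mul_div]
  have h1 : (j : ℝ) ≤ j * ((n : ℝ) - j - i) / (n - j - m) := by
    rw [le_div_iff₀ (by linarith)]
    exact mul_le_mul_of_nonneg_left (by linarith) (by linarith)
  linarith

/-- Gamma limit of the Pólya weights, as a lower bound. -/
lemma exists_le_polyaWeight_gamma {r : ℝ} (hr : 0 < r) (l : ℕ) {j : ℕ → ℕ}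
    (hj : Tendsto j atTop atTop) (hc : Tendsto (fun n : ℕ => (n : ℝ) / j n) atTop atTop) {x : ℝ}
    (hx : 0 < x) :
    ∃ lo : ℕ → ℝ, Tendsto lo atTop (𝓝 (gammaPDFReal r 1 x)) ∧ ∀ᶠ n : ℕ in atTop,
      lo n ≤ (n : ℝ) / j n * polyaWeight r (j n - l) (n - j n) ⌊x * ((n : ℝ) / j n)⌋₊ := by
  set c : ℕ → ℝ := fun n => (n : ℝ) / j n with hc_def
  have hj' : Tendsto (fun n => (j n : ℝ)) atTop atTop := tendsto_natCast_atTop_atTop.comp hj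
  have hfl := tendsto_floor_mul_div hc hx.le
  -- With c = n/j and m = ⌊x c⌋, one has j/n = 1/c and m/n = (m/c)(1/j), both of which tend to 0.
  have hmn : Tendsto (fun n : ℕ => (j n + ⌊x * c n⌋₊ : ℝ) / n) atTop (𝓝 0) := by
    have h1 : Tendsto (fun n : ℕ => (c n)⁻¹ + (⌊x * c n⌋₊ : ℝ) / c n * (j n : ℝ)⁻¹) atTop
        (𝓝 (0 + x * 0)) := hc.inv_tendsto_atTop.add (hfl.mul hj'.inv_tendsto_atTop)
    simp only [mul_zero, add_zero] at h1
    refine h1.congr' ?_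
    filter_upwards [hj'.eventually_gt_atTop 0, eventually_gt_atTop 0] with n h1 h2
    have h2' : (0 : ℝ) < n := by exact_mod_cast h2
    simp only [hc_def]
    field_simp
  have hlt : ∀ᶠ n : ℕ in atTop, j n + ⌊x * c n⌋₊ < n := by
    filter_upwards [hmn.eventually_lt_const one_pos, eventually_gt_atTop 0] with n h1 h2
    have h2' : (0 : ℝ) < n := by exact_mod_cast h2
    rw [div_lt_one h2'] at h1
    exact_mod_cast h1
  -- The exponent equals (m/c) / (1 − (j + m)/n), hence tends to x.
  have hexp : Tendsto (fun n : ℕ => (⌊x * c n⌋₊ : ℝ) * ((j n : ℝ) / (n - j n - ⌊x * c n⌋₊))) atTop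
      (𝓝 x) := by
    have h1 := hfl.div (hmn.const_sub 1) (by norm_num)
    simp only [sub_zero, div_one] at h1
    refine h1.congr' ?_
    filter_upwards [hj'.eventually_gt_atTop 0, eventually_gt_atTop 0, hlt] with n h1 h2 h3
    have h2' : (0 : ℝ) < n := by exact_mod_cast h2
    have h3' : (j n : ℝ) + ⌊x * c n⌋₊ < n := by exact_mod_cast h3
    have h4 : (n : ℝ) - j n - ⌊x * c n⌋₊ ≠ 0 := by linarith
    have h5 : 1 - ((j n : ℝ) + ⌊x * c n⌋₊) / n ≠ 0 := by
      rw [one_sub_div h2'.ne', ← sub_sub]; exact div_ne_zero h4 h2'.ne'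
    simp only [Pi.div_apply]
    rw [one_sub_div h2'.ne', ← sub_sub]
    simp only [hc_def] at h4 ⊢
    field_simp
  have hE := (Real.continuous_exp.tendsto _).comp hexp.neg
  have h := ((tendsto_prod_div_add_one_floor hr hc hx).mul
    (tendsto_rpow_mul_Gamma_ratio hr l hj)).mul hE
  have hlim : 1 / Real.Gamma r * x ^ (r - 1) * 1 * Real.exp (-x) = gammaPDFReal r 1 x := by
    rw [gammaPDFReal, if_pos hx.le, Real.one_rpow]
    ring_nf
  rw [hlim] at h
  refine ⟨_, h, ?_⟩
  · filter_upwards [hlt, hj.eventually_gt_atTop l, hc.eventually_gt_atTop 0] with n h1 h2 h3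
    have hcpos : 0 < c n := h3
    have hp := Real.rpow_pos_of_pos hcpos r
    rw [polyaWeight_eq hr h2 (by omega)]
    have hG : 0 ≤ Real.Gamma ((n : ℝ) - l) / Real.Gamma (r + (n - l)) /
        (Real.Gamma (j n - l) / Real.Gamma (r + (j n - l))) := by
      rw [← prod_div_eq_Gamma hr h2 (by omega)]
      refine Finset.prod_nonneg fun i _ => ?_
      have : (l : ℝ) < j n := by exact_mod_cast h2
      have : (0 : ℝ) < j n - l := by linarith
      positivity
    have key := mul_le_mul_of_nonneg_left (exp_le_prod_sub_div h2 h1)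
      (mul_nonneg hcpos.le (mul_nonneg (prod_div_add_one_nonneg hr ⌊x * c n⌋₊) hG))
    refine le_trans (le_of_eq ?_) (key.trans (le_of_eq ?_))
    · simp only [Function.comp]
      rw [Real.rpow_sub_one hcpos.ne']
      have : ∀ P G E : ℝ, P / (c n ^ r / c n) * (c n ^ r * G) * E = c n * (P * G) * E := by
        intro P G E; field_simp
      exact this _ _ _
    · simp only [hc_def]; ring

/-- Negative binomial limit of the Pólya weights. -/
lemma tendsto_polyaWeight_negBin {r : ℝ} (hr : 0 < r) (l : ℕ) {j : ℕ → ℕ} {ρ : ℝ} (h0 : 0 < ρ)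
    (h1 : ρ < 1) (hj : Tendsto (fun n : ℕ => (j n : ℝ) / n) atTop (𝓝 ρ)) (m : ℕ) :
    Tendsto (fun n : ℕ => polyaWeight r (j n - l) (n - j n) m) atTop
      (𝓝 (Ring.choose (r + m - 1) m * ρ ^ r * (1 - ρ) ^ m)) := by
  have hc : Tendsto (fun n : ℕ => (n : ℝ)) atTop atTop := tendsto_natCast_atTop_atTop
  have hj' : Tendsto (fun n => (j n : ℝ)) atTop atTop := by
    refine (hj.pos_mul_atTop h0 hc).congr' ?_
    filter_upwards [hc.eventually_gt_atTop 0] with n hn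
    field_simp
  have hjtop : Tendsto j atTop atTop := tendsto_natCast_atTop_iff.1 hj'
  have hjn : ∀ᶠ n : ℕ in atTop, j n ≤ n := by
    filter_upwards [hj.eventually_lt_const h1, hc.eventually_gt_atTop 0] with n h1 h2
    rw [div_lt_one h2] at h1
    exact_mod_cast h1.le
  have hQ : Tendsto (fun n : ℕ => ∏ i ∈ Finset.range m,
      ((n : ℝ) - j n - i) / (n - l - 1 - i)) atTop (𝓝 ((1 - ρ) ^ m)) := by
    have hfac : ∀ i ∈ Finset.range m, Tendsto (fun n : ℕ =>
        ((n : ℝ) - j n - i) / (n - l - 1 - i)) atTop (𝓝 (1 - ρ)) := by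
      intro i _
      have h2 : Tendsto (fun n : ℕ => (1 - (j n : ℝ) / n - i / n) *
          ((n : ℝ) / (n + (-(l + 1 + i))))) atTop (𝓝 ((1 - ρ - 0) * 1)) :=
        ((hj.const_sub 1).sub (hc.const_div_atTop _)).mul (tendsto_natCast_div_add_atTop _)
      rw [mul_one, sub_zero] at h2
      refine h2.congr' ?_
      filter_upwards [eventually_gt_atTop (l + 1 + i)] with n hn
      have hn' : (l : ℝ) + 1 + i < n := by exact_mod_cast hn
      have h2 : (0 : ℝ) < n := lt_of_le_of_lt (by positivity) hn'
      have h3 : (n : ℝ) - l - 1 - i ≠ 0 := by linarith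
      rw [show (n : ℝ) + (-(l + 1 + i)) = n - l - 1 - i by ring]
      field_simp
    have hP := tendsto_finsetProd (Finset.range m) hfac
    rwa [Finset.prod_const, Finset.card_range] at hP
  have hchoose : ∏ i ∈ Finset.range m, (r + i) / ((i : ℝ) + 1) = Ring.choose (r + m - 1) m := by
    have h := Ring.factorial_nsmul_multichoose_eq_ascPochhammer r m
    have hasc : ∀ k, (ascPochhammer ℝ k).eval r = ∏ i ∈ Finset.range k, (r + i) := by
      intro k
      induction k with
      | zero => simp
      | succ k ih => rw [ascPochhammer_succ_eval, ih, Finset.prod_range_succ]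
    rw [Polynomial.ascPochhammer_smeval_eq_eval, nsmul_eq_mul, Ring.multichoose_eq, hasc] at h
    rw [Finset.prod_div_distrib, ← h, div_eq_iff, mul_comm]
    · congr 1
      rw [← Finset.prod_range_add_one_eq_factorial]
      push_cast; rfl
    · exact Finset.prod_ne_zero_iff.2 fun i _ => by positivity
  -- Here (j/n)^r supplies the factor ρ^r and cancels the power (n/j)^r used to normalize the Gamma
  -- ratio.
  have h := (((hj.rpow_const (p := r) (Or.inl h0.ne')).mul
    (tendsto_rpow_mul_Gamma_ratio hr l hjtop)).const_mul
      (∏ i ∈ Finset.range m, (r + i) / ((i : ℝ) + 1))).mul hQ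
  rw [hchoose, mul_one] at h
  refine h.congr' ?_
  filter_upwards [hjtop.eventually_gt_atTop l, hjn, hc.eventually_gt_atTop 0] with n h2 h3 h4
  have h5 : (0 : ℝ) < j n := by exact_mod_cast (Nat.zero_le l).trans_lt h2
  rw [polyaWeight_eq hr h2 h3, hchoose]
  have : ((j n : ℝ) / n) ^ r * ((n : ℝ) / j n) ^ r = 1 := by
    rw [← Real.mul_rpow (by positivity) (by positivity), div_mul_div_cancel₀ h4.ne',
      div_self h5.ne', Real.one_rpow]
  rw [← mul_assoc (((j n : ℝ) / n) ^ r), this, one_mul]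

/-! ### From densities to weak convergence -/

/-- Convergence of densities, even as a lower bound only, implies weak convergence. -/
lemma tendsto_probabilityMeasure_of_le_liminf_density {Ω E : Type*} [MeasurableSpace Ω]
    {ν : Measure Ω} [TopologicalSpace E] [MeasurableSpace E] [OpensMeasurableSpace E]
    {μs : ℕ → ProbabilityMeasure E} {μ : ProbabilityMeasure E} {h : ℕ → Ω → E} {H : Ω → E}
    {g : ℕ → Ω → ENNReal} {G : Ω → ENNReal} (hh : ∀ n, Measurable (h n))
    (hg : ∀ n, Measurable (g n))
    (hμs : ∀ᶠ n in atTop, ∀ U, IsOpen U →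
      (μs n : Measure E) U = ∫⁻ x, U.indicator 1 (h n x) * g n x ∂ν)
    (hμ : ∀ U, IsOpen U → (μ : Measure E) U = ∫⁻ x, U.indicator 1 (H x) * G x ∂ν)
    (hlim : ∀ᵐ x ∂ν, Tendsto (fun n => h n x) atTop (𝓝 (H x)))
    (hG : ∀ᵐ x ∂ν, G x ≤ liminf (fun n => g n x) atTop) :
    Tendsto μs atTop (𝓝 μ) := by
  -- By the portmanteau theorem, lower bounds on open sets suffice, and Fatou's lemma yields them.
  -- No upper bound is needed because the limit has full mass 1.
  refine tendsto_of_forall_isOpen_le_liminf' fun U hU => ?_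
  rw [hμ U hU, liminf_congr (hμs.mono fun n hn => hn U hU)]
  refine le_trans (lintegral_mono_ae ?_) (lintegral_liminf_le fun n =>
    ((measurable_one.indicator hU.measurableSet).comp (hh n)).mul (hg n))
  filter_upwards [hlim, hG] with x h1 h2
  by_cases hx : H x ∈ U
  · rw [Set.indicator_of_mem hx, Pi.one_apply, one_mul]
    refine h2.trans (le_of_eq (liminf_congr ?_))
    filter_upwards [h1.eventually_mem (hU.mem_nhds hx)] with n hn
    rw [Set.indicator_of_mem hn, Pi.one_apply, one_mul]
  · rw [Set.indicator_of_notMem hx, zero_mul]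
    exact zero_le

lemma ofReal_le_liminf {lo γ : ℕ → ℝ} {x : ℝ} (h : Tendsto lo atTop (𝓝 x))
    (hle : ∀ᶠ n in atTop, lo n ≤ γ n) :
    ENNReal.ofReal x ≤ liminf (fun n => ENNReal.ofReal (γ n)) atTop := by
  rw [← (ENNReal.tendsto_ofReal h).liminf_eq]
  exact liminf_le_liminf (hle.mono fun n hn => ENNReal.ofReal_le_ofReal hn)

/-- A sum over the nonnegative integers as an integral of a step function. -/
lemma lintegral_floor_mul {c : ℝ} (hc : 0 < c) (φ : ℕ → ENNReal) :
    ∫⁻ x in Set.Ioi 0, ENNReal.ofReal c * φ ⌊x * c⌋₊ = ∑' m, φ m := by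
  rw [Measure.restrict_congr_set (Ioi_ae_eq_Ici (a := (0 : ℝ)))]
  have hmem : ∀ (x : ℝ) (m : ℕ), x ∈ Set.Ico (m / c) ((m + 1) / c) ↔ 0 ≤ x ∧ ⌊x * c⌋₊ = m := by
    intro x m
    rw [Set.mem_Ico, div_le_iff₀ hc, lt_div_iff₀ hc]
    constructor
    · rintro ⟨h1, h2⟩
      have h3 : 0 ≤ x * c := le_trans (by positivity) h1
      exact ⟨nonneg_of_mul_nonneg_left h3 hc, (Nat.floor_eq_iff h3).2 ⟨h1, h2⟩⟩
    · rintro ⟨h1, h2⟩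
      exact (Nat.floor_eq_iff (by positivity)).1 h2
  have hU : Set.Ici (0 : ℝ) = ⋃ m : ℕ, Set.Ico (m / c) ((m + 1) / c) := by
    ext x
    simp only [Set.mem_iUnion, hmem, Set.mem_Ici]
    exact ⟨fun h => ⟨_, h, rfl⟩, fun ⟨_, h, _⟩ => h⟩
  rw [hU, lintegral_iUnion (fun _ => measurableSet_Ico) (fun m m' hmm' =>
    Set.disjoint_left.2 fun x hx hx' => hmm' (((hmem x m).1 hx).2.symm.trans ((hmem x m').1 hx').2))]
  refine tsum_congr fun m => ?_
  rw [setLIntegral_congr_fun measurableSet_Ico (g := fun _ => ENNReal.ofReal c * φ m)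
    (fun x hx => by simp only [((hmem x m).1 hx).2]), setLIntegral_const, Real.volume_Ico,
    show ((m : ℝ) + 1) / c - m / c = c⁻¹ by field_simp; ring, mul_comm, ← mul_assoc,
    ← ENNReal.ofReal_mul (by positivity), inv_mul_cancel₀ hc.ne', ENNReal.ofReal_one, one_mul]

lemma bind_apply_eq_sum {E : Type*} [MeasurableSpace E] {lam : Measure ℕ} {b : ℕ}
    (hlam : ∀ᵐ l ∂lam, 1 ≤ l ∧ l ≤ b) (κ : ℕ → Measure E) {U : Set E} (hU : MeasurableSet U) :
    lam.bind κ U = ∑ l ∈ Finset.Icc 1 b, lam {l} * κ l U := by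
  rw [Measure.bind_apply hU Measurable.of_discrete.aemeasurable, lintegral_countable',
    tsum_eq_sum (s := Finset.Icc 1 b)]
  · exact Finset.sum_congr rfl fun l _ => mul_comm _ _
  · intro l hl
    have : lam {l} = 0 := by
      rw [measure_eq_zero_iff_ae_notMem]
      filter_upwards [hlam] with k hk
      rintro rfl
      exact hl (Finset.mem_Icc.2 hk)
    rw [this, mul_zero]

/-! ### Limit laws of the number of descendants -/

namespace BucketFamily

lemma limitSizeWeight_nonneg (F : BucketFamily) (b : ℕ) {m : ℕ} (hm : 1 ≤ m) :
    0 ≤ F.limitSizeWeight b m := by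
  have h1 := F.add_kappa_pos hm
  have : 0 ≤ ∑ k ∈ Finset.Icc 1 b, 1 / ((k : ℝ) + F.kappa) :=
    Finset.sum_nonneg fun k hk => (one_div_pos.2 (F.add_kappa_pos (Finset.mem_Icc.1 hk).1)).le
  unfold limitSizeWeight
  positivity

lemma limitSizeLaw_singleton (F : BucketFamily) {b m : ℕ} (hm : m ∈ Finset.Icc 1 b) :
    F.limitSizeLaw b {m} = ENNReal.ofReal (F.limitSizeWeight b m) := by
  simp only [limitSizeLaw, Measure.coe_finsetSum, Finset.sum_apply, Measure.smul_apply,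
    smul_eq_mul]
  rw [Finset.sum_eq_single m]
  · simp
  · intro k _ hk
    rw [Measure.dirac_apply' _ (by measurability), Set.indicator_of_notMem (by simpa using hk),
      mul_zero]
  · exact fun h => absurd hm h

lemma initialSizeLaw_singleton (F : BucketFamily) (b j m : ℕ) :
    F.initialSizeLaw b j {m} = ENNReal.ofReal (F.initialSizeProb b j m) := by
  unfold initialSizeLaw initialSizeProb
  rw [Measure.map_apply (measurable_of_bucketTree _) (by measurability), ofReal_measureReal]
  rfl

/-- The probabilities of the number of descendants of `j`, apart from `j` itself, in the random
tree of size `n`. -/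
noncomputable def descendantsWeight (F : BucketFamily) (b n j m : ℕ) : ℝ :=
  ∑ l ∈ Finset.Icc 1 b, F.initialSizeProb b j l * polyaWeight (l + F.kappa) (j - l) (n - j) m

lemma polyaWeight_kappa_nonneg (F : BucketFamily) {b j l : ℕ} (hl : l ∈ Finset.Icc 1 b)
    (hj : b < j) (N m : ℕ) : 0 ≤ polyaWeight (l + F.kappa) (j - l) N m := by
  have hl' := Finset.mem_Icc.1 hl
  refine polyaWeight_nonneg (F.add_kappa_pos hl'.1) ?_ N m
  have : ((l + 1 : ℕ) : ℝ) ≤ j := by exact_mod_cast (by omega : l + 1 ≤ j)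
  push_cast at this; linarith

lemma treeLaw_descendants (F : BucketFamily) {b j n : ℕ} (hb : 1 ≤ b) (hj : b < j) (hn : j ≤ n)
    (m : ℕ) : F.treeLaw b n {T | T.descendants j = m + 1} =
      ENNReal.ofReal (F.descendantsWeight b n j m) := by
  have h1 : F.treeLaw b n {T | T.descendants j = m + 1} =
      F.treeLaw b n (⋃ l ∈ Finset.Icc 1 b, {T | T.initialSize j = l ∧ T.descendants j = m + 1}) := by
    refine measure_congr (eventuallyEq_set.2 ?_)
    filter_upwards [F.ae_treeLaw b (n := n) (by omega)] with T ⟨hV, _, hs⟩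
    have hpos := T.initialSize_pos (j := j) (by omega)
    have hle : T.initialSize j ≤ b := by
      have h2 := hV.cap_le (T.node j)
      rw [max_eq_left hb] at h2
      refine le_trans (Finset.card_le_card (Finset.filter_subset_filter _ ?_)) h2
      exact Finset.Icc_subset_Icc_right (by omega)
    simp [hpos, hle]
  rw [h1, measure_biUnion_finset
    (fun l _ l' _ hll' => Set.disjoint_left.2 fun T h h' => hll' (h.1.symm.trans h'.1))
    (fun _ _ => measurableSet_bucketTree _), descendantsWeight, ENNReal.ofReal_sum_of_nonneg
    (fun l hl => mul_nonneg (F.initialSizeProb_nonneg b j l) (F.polyaWeight_kappa_nonneg hl hj _ _))]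
  refine Finset.sum_congr rfl fun l hl => ?_
  have hl' := Finset.mem_Icc.1 hl
  obtain ⟨N, rfl⟩ := Nat.exists_eq_add_of_le hn
  rw [F.treeLaw_initialSize_descendants b hl'.1 (by omega),
    ENNReal.ofReal_mul (F.initialSizeProb_nonneg b j l), initialSizeProb, ofReal_measureReal,
    Nat.add_sub_cancel_left]

lemma map_descendants_apply (F : BucketFamily) {b j n : ℕ} (hb : 1 ≤ b) (hj : b < j) (hn : j ≤ n)
    {E : Type*} [MeasurableSpace E] (φ : ℕ → E) {U : Set E} (hU : MeasurableSet U) :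
    (F.treeLaw b n).map (fun T => φ (T.descendants j)) U =
      ∑' m : ℕ, U.indicator 1 (φ (m + 1)) * ENNReal.ofReal (F.descendantsWeight b n j m) := by
  rw [Measure.map_apply (measurable_of_bucketTree _) hU]
  have h1 : F.treeLaw b n ((fun T => φ (T.descendants j)) ⁻¹' U) =
      F.treeLaw b n (⋃ m : ℕ, {T | T.descendants j = m + 1 ∧ φ (m + 1) ∈ U}) := by
    refine measure_congr (eventuallyEq_set.2 ?_)
    filter_upwards [F.ae_treeLaw b (n := n) (by omega)] with T ⟨_, _, hs⟩
    obtain ⟨k, hk⟩ := Nat.exists_eq_add_of_le' (T.descendants_pos (j := j) (by omega))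
    simp [hk]
  rw [h1, measure_iUnion (fun m m' hmm' => Set.disjoint_left.2 fun T h h' =>
    hmm' (by have := h.1.symm.trans h'.1; omega)) (fun _ => measurableSet_bucketTree _)]
  refine tsum_congr fun m => ?_
  rw [← F.treeLaw_descendants hb hj hn]
  by_cases h : φ (m + 1) ∈ U <;> simp [h]

/-- Continuous limit laws of the rescaled number of descendants. -/
lemma tendstoInDistribution_descendants_div (F : BucketFamily) {b : ℕ} (hb : 1 ≤ b) {j : ℕ → ℕ}
    {c : ℕ → ℝ} (hj : ∀ᶠ n in atTop, b < j n ∧ j n ≤ n) (hc : Tendsto c atTop atTop) {w : ℕ → ℝ}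
    (hw0 : ∀ l ∈ Finset.Icc 1 b, 0 ≤ w l)
    (hw : ∀ l ∈ Finset.Icc 1 b, Tendsto (fun n => F.initialSizeProb b (j n) l) atTop (𝓝 (w l)))
    {f : ℕ → ℝ → ℝ} (hf : ∀ l, Measurable (f l)) (hf0 : ∀ l ∈ Finset.Icc 1 b, ∀ x, 0 ≤ f l x)
    (hneg : ∀ l, ∀ x < 0, f l x = 0)
    (hlo : ∀ l ∈ Finset.Icc 1 b, ∀ x > 0, x ≠ 1 → ∃ lo : ℕ → ℝ,
      Tendsto lo atTop (𝓝 (f l x)) ∧ ∀ᶠ n in atTop,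
        lo n ≤ c n * polyaWeight (l + F.kappa) (j n - l) (n - j n) ⌊x * c n⌋₊)
    {μ : ProbabilityMeasure ℝ} (hμ : ∀ U, MeasurableSet U → (μ : Measure ℝ) U =
      ∑ l ∈ Finset.Icc 1 b, ENNReal.ofReal (w l) * ∫⁻ x in U, ENNReal.ofReal (f l x)) :
    TendstoInDistribution (fun (n : ℕ) (T : BucketTree) => (T.descendants (j n) : ℝ) / c n) atTop id
      (fun n => F.treeLaw b n) (μ : Measure ℝ) := by
  refine ⟨fun n => aemeasurable_of_bucketTree _ _, aemeasurable_id, ?_⟩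
  have hid : (⟨(μ : Measure ℝ).map id, Measure.isProbabilityMeasure_map aemeasurable_id⟩ :
      ProbabilityMeasure ℝ) = μ := Subtype.ext Measure.map_id
  rw [hid]
  -- The discrete law is realized on (0, ∞): x is sent to the atom (⌊x c⌋ + 1)/c, which converges to
  -- x, with the step density c times the weight of ⌊x c⌋. The shift by 1 is the label j itself.
  refine tendsto_probabilityMeasure_of_le_liminf_density (ν := volume.restrict (Set.Ioi 0))
    (h := fun n x => ((⌊x * c n⌋₊ + 1 : ℕ) : ℝ) / c n) (H := fun x => x)
    (g := fun n x => ENNReal.ofReal (c n * F.descendantsWeight b n (j n) ⌊x * c n⌋₊))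
    (G := fun x => ENNReal.ofReal (∑ l ∈ Finset.Icc 1 b, w l * f l x)) ?_ ?_ ?_ ?_ ?_ ?_
  · intro n
    exact (Measurable.of_discrete (f := fun m : ℕ => ((m + 1 : ℕ) : ℝ) / c n)).comp
      (Nat.measurable_floor.comp (measurable_id.mul_const _))
  · intro n
    exact (Measurable.of_discrete (f := fun m : ℕ =>
      ENNReal.ofReal (c n * F.descendantsWeight b n (j n) m))).comp
      (Nat.measurable_floor.comp (measurable_id.mul_const _))
  · filter_upwards [hj, hc.eventually_gt_atTop 0] with n ⟨h1, h2⟩ h3 U hU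
    refine (F.map_descendants_apply hb h1 h2 (fun k => (k : ℝ) / c n) hU.measurableSet).trans ?_
    rw [← lintegral_floor_mul h3]
    refine lintegral_congr fun x => ?_
    rw [ENNReal.ofReal_mul h3.le]
    ring
  · intro U hU
    rw [hμ U hU.measurableSet, ← lintegral_indicator measurableSet_Ioi]
    have hstep : ∀ l ∈ Finset.Icc 1 b, ENNReal.ofReal (w l) * ∫⁻ x in U, ENNReal.ofReal (f l x) =
        ∫⁻ x, U.indicator 1 x * (ENNReal.ofReal (w l) * ENNReal.ofReal (f l x)) := by
      intro l _
      have hm : Measurable fun x => ENNReal.ofReal (f l x) := ENNReal.measurable_ofReal.comp (hf l)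
      rw [← lintegral_indicator hU.measurableSet,
        ← lintegral_const_mul _ (hm.indicator hU.measurableSet)]
      refine lintegral_congr fun x => ?_
      by_cases hx : x ∈ U <;> simp [hx]
    rw [Finset.sum_congr rfl hstep, ← lintegral_finsetSum]
    · refine lintegral_congr_ae ?_
      filter_upwards [Measure.ae_ne volume (0 : ℝ)] with x hx
      rw [← Finset.mul_sum]
      rcases lt_or_gt_of_ne hx with hx | hx
      · rw [Set.indicator_of_notMem (s := Set.Ioi 0) (by simpa using hx.le), Finset.sum_eq_zero,
          mul_zero]
        intro l _
        rw [hneg l x hx, ENNReal.ofReal_zero, mul_zero]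
      · rw [Set.indicator_of_mem (s := Set.Ioi 0) (by simpa using hx), ENNReal.ofReal_sum_of_nonneg
          (fun l hl => mul_nonneg (hw0 l hl) (hf0 l hl x))]
        congr 1
        exact Finset.sum_congr rfl fun l hl => (ENNReal.ofReal_mul (hw0 l hl)).symm
    · intro l _
      exact (measurable_one.indicator hU.measurableSet).mul
        ((ENNReal.measurable_ofReal.comp (hf l)).const_mul _)
  · refine (ae_restrict_mem measurableSet_Ioi).mono fun x hx => ?_
    have h1 := (tendsto_floor_mul_div hc (le_of_lt hx)).add hc.inv_tendsto_atTop
    rw [add_zero] at h1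
    refine h1.congr fun n => ?_
    push_cast
    rw [add_div, one_div]; rfl
  -- The endpoint 1 of the beta density is a null set, so the bounds need not cover it.
  · filter_upwards [ae_restrict_mem measurableSet_Ioi,
      ae_restrict_of_ae (Measure.ae_ne volume (1 : ℝ))] with x hx hx1
    have hex : ∀ l : ℕ, ∃ lo : ℕ → ℝ, l ∈ Finset.Icc 1 b → Tendsto lo atTop (𝓝 (f l x)) ∧
        ∀ᶠ n in atTop, lo n ≤ c n * polyaWeight (l + F.kappa) (j n - l) (n - j n) ⌊x * c n⌋₊ := by
      intro l
      by_cases hl : l ∈ Finset.Icc 1 b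
      · obtain ⟨lo, h⟩ := hlo l hl x hx hx1
        exact ⟨lo, fun _ => h⟩
      · exact ⟨0, fun h => absurd h hl⟩
    choose lo hlo' using hex
    refine ofReal_le_liminf (lo := fun n => ∑ l ∈ Finset.Icc 1 b, F.initialSizeProb b (j n) l * lo l n)
      (tendsto_finsetSum _ fun l hl => (hw l hl).mul (hlo' l hl).1) ?_
    filter_upwards [(Finset.eventually_all _).2 fun l hl => (hlo' l hl).2] with n hn
    rw [descendantsWeight, Finset.mul_sum]
    refine Finset.sum_le_sum fun l hl => ?_
    calc _ ≤ _ := mul_le_mul_of_nonneg_left (hn l hl) (F.initialSizeProb_nonneg b (j n) l)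
      _ = _ := by ring

/-- With respect to the counting measure on ℕ the densities are the point masses, so their pointwise
convergence is enough. -/
lemma tendstoInDistribution_initialSize (F : BucketFamily) {b : ℕ} (hb : 1 ≤ b) :
    TendstoInDistribution (fun n (T : BucketTree) => T.cap (T.node n)) atTop id
      (fun n => F.treeLaw b n) (F.limitSize b hb : Measure ℕ) := by
  refine ⟨fun n => aemeasurable_of_bucketTree _ _, aemeasurable_id, ?_⟩
  have hid : (⟨(F.limitSize b hb : Measure ℕ).map id,
      Measure.isProbabilityMeasure_map aemeasurable_id⟩ : ProbabilityMeasure ℕ) =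
      F.limitSize b hb := Subtype.ext Measure.map_id
  rw [hid]
  refine tendsto_probabilityMeasure_of_le_liminf_density (ν := Measure.count)
    (h := fun _ m => m) (H := fun m => m)
    (g := fun n m => ENNReal.ofReal (F.initialSizeProb b n m))
    (G := fun m => F.limitSizeLaw b {m}) (fun _ => measurable_id)
    (fun _ => Measurable.of_discrete) ?_ ?_ ?_ ?_
  · refine Eventually.of_forall fun n U hU => ?_
    change F.initialSizeLaw b n U = _
    rw [← lintegral_indicator_one hU.measurableSet, lintegral_countable', lintegral_count]
    simp only [initialSizeLaw_singleton]
  · intro U hU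
    change F.limitSizeLaw b U = _
    rw [← lintegral_indicator_one hU.measurableSet, lintegral_countable', lintegral_count]
  · exact Eventually.of_forall fun _ => tendsto_const_nhds
  · refine Eventually.of_forall fun m => ?_
    by_cases hm : m ∈ Finset.Icc 1 b
    · rw [F.limitSizeLaw_singleton hm]
      have hm' := Finset.mem_Icc.1 hm
      exact ofReal_le_liminf (F.tendsto_initialSizeProb hm'.1 hm'.2)
        (Eventually.of_forall fun _ => le_rfl)
    · have : F.limitSizeLaw b {m} = 0 := by
        rw [measure_eq_zero_iff_ae_notMem]
        filter_upwards [F.ae_limitSizeLaw b] with k hk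
        rintro rfl
        exact hm (Finset.mem_Icc.2 hk)
      rw [this]
      exact zero_le

lemma tendstoInDistribution_beta (F : BucketFamily) {b : ℕ} (hb : 1 ≤ b) (j : ℕ) (hj : b + 1 ≤ j) :
    TendstoInDistribution (fun (n : ℕ) (T : BucketTree) => (T.descendants j : ℝ) / n) atTop id
      (fun n => F.treeLaw b n) (F.betaLimit b j hb hj : Measure ℝ) := by
  have hpos : ∀ l ∈ Finset.Icc 1 b, (0 : ℝ) < j - l := by
    intro l hl
    have hl' := Finset.mem_Icc.1 hl
    have : (l : ℝ) < j := by exact_mod_cast (by omega : l < j)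
    linarith
  have hbeta0 : ∀ l ∈ Finset.Icc 1 b, ∀ x, 0 ≤ betaPDFReal (l + F.kappa) (j - l) x := by
    intro l hl x
    by_cases hx : 0 < x ∧ x < 1
    · exact (betaPDFReal_pos hx.1 hx.2 (F.add_kappa_pos (Finset.mem_Icc.1 hl).1) (hpos l hl)).le
    · rw [betaPDFReal, if_neg hx]
  refine F.tendstoInDistribution_descendants_div hb (j := fun _ => j) (c := fun n => (n : ℝ))
    (w := fun l => F.initialSizeProb b j l) (f := fun l => betaPDFReal (l + F.kappa) (j - l))
    ?_ tendsto_natCast_atTop_atTop (fun l _ => F.initialSizeProb_nonneg b j l)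
    (fun _ _ => tendsto_const_nhds) (fun l => measurable_betaPDFReal _ _) hbeta0 ?_ ?_ ?_
  · filter_upwards [eventually_ge_atTop j] with n hn
    exact ⟨hj, hn⟩
  · intro l x hx
    rw [betaPDFReal, if_neg (fun h => (h.1.trans hx).false)]
  · intro l hl x hx hx1
    have hl' := Finset.mem_Icc.1 hl
    rcases lt_or_gt_of_ne hx1 with hx1 | hx1
    · exact ⟨_, tendsto_polyaWeight_beta (F.add_kappa_pos hl'.1) (by omega) hx hx1,
        Eventually.of_forall fun _ => le_rfl⟩
    -- Beyond 1 the limiting density is 0 and the trivial lower bound suffices.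
    · refine ⟨0, ?_, Eventually.of_forall fun n => mul_nonneg (by positivity)
        (F.polyaWeight_kappa_nonneg hl hj _ _)⟩
      rw [betaPDFReal, if_neg (fun h => (h.2.trans hx1).false)]
      exact tendsto_const_nhds
  · intro U hU
    change (F.initialSizeLaw b j).bind _ U = _
    rw [bind_apply_eq_sum (F.ae_initialSizeLaw hb (by omega)) _ hU]
    refine Finset.sum_congr rfl fun l _ => ?_
    rw [initialSizeLaw_singleton, betaMeasure, withDensity_apply _ hU]
    rfl

/-- The scale is n / j n. As j n → ∞, the mixing weights, which are the probabilities of the initial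
sizes at time j n, converge to those of K. -/
lemma tendstoInDistribution_gamma (F : BucketFamily) {b : ℕ} (hb : 1 ≤ b) {j : ℕ → ℕ}
    (hj : Tendsto j atTop atTop) (hjn : (fun n => (j n : ℝ)) =o[atTop] (fun n : ℕ => (n : ℝ))) :
    TendstoInDistribution
        (fun (n : ℕ) (T : BucketTree) => (j n : ℝ) * (T.descendants (j n) : ℝ) / n) atTop id
        (fun n => F.treeLaw b n) (F.gammaLimit b hb : Measure ℝ) := by
  have h0 := hjn.tendsto_div_nhds_zero
  have hc : Tendsto (fun n : ℕ => (n : ℝ) / j n) atTop atTop := by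
    have : Tendsto (fun n : ℕ => (j n : ℝ) / n) atTop (𝓝[>] 0) := by
      refine tendsto_nhdsWithin_iff.2 ⟨h0, ?_⟩
      filter_upwards [hj.eventually_gt_atTop 0, eventually_gt_atTop 0] with n h1 h2
      have h1' : (0 : ℝ) < j n := by exact_mod_cast h1
      have h2' : (0 : ℝ) < n := by exact_mod_cast h2
      exact div_pos h1' h2'
    refine this.inv_tendsto_nhdsGT_zero.congr fun n => ?_
    simp
  have hfun : (fun (n : ℕ) (T : BucketTree) => (j n : ℝ) * (T.descendants (j n) : ℝ) / n) =
      fun (n : ℕ) (T : BucketTree) => (T.descendants (j n) : ℝ) / ((n : ℝ) / j n) := by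
    funext n T
    rw [div_div_eq_mul_div, mul_comm]
  rw [hfun]
  refine F.tendstoInDistribution_descendants_div hb
    (w := fun l => F.limitSizeWeight b l) (f := fun l => gammaPDFReal (l + F.kappa) 1)
    ?_ hc (fun l hl => F.limitSizeWeight_nonneg b (Finset.mem_Icc.1 hl).1)
    (fun l hl => (F.tendsto_initialSizeProb (Finset.mem_Icc.1 hl).1 (Finset.mem_Icc.1 hl).2).comp hj)
    (fun l => measurable_gammaPDFReal _ _)
    (fun l hl => gammaPDFReal_nonneg (F.add_kappa_pos (Finset.mem_Icc.1 hl).1) one_pos)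
    ?_ ?_ ?_
  · filter_upwards [hj.eventually_gt_atTop b, h0.eventually_lt_const one_pos,
      eventually_gt_atTop 0] with n h1 h2 h3
    have h3' : (0 : ℝ) < n := by exact_mod_cast h3
    rw [div_lt_one h3'] at h2
    exact ⟨h1, by exact_mod_cast h2.le⟩
  · intro l x hx
    rw [gammaPDFReal, if_neg hx.not_ge]
  · intro l hl x hx _
    exact exists_le_polyaWeight_gamma (F.add_kappa_pos (Finset.mem_Icc.1 hl).1) l hj hc hx
  · intro U hU
    change (F.limitSizeLaw b).bind _ U = _
    rw [bind_apply_eq_sum (F.ae_limitSizeLaw b) _ hU]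
    refine Finset.sum_congr rfl fun l hl => ?_
    rw [F.limitSizeLaw_singleton hl, gammaMeasure, withDensity_apply _ hU]
    rfl

lemma tendstoInDistribution_negBin (F : BucketFamily) {b : ℕ} (hb : 1 ≤ b) {j : ℕ → ℕ} {ρ : ℝ}
    (h0 : 0 < ρ) (h1 : ρ < 1) (hj : Tendsto (fun n : ℕ => (j n : ℝ) / n) atTop (𝓝 ρ)) :
    TendstoInDistribution
        (fun (n : ℕ) (T : BucketTree) => (T.descendants (j n) : ℝ) - 1) atTop id
        (fun n => F.treeLaw b n) (F.negBinLimit b hb ρ h0 h1 : Measure ℝ) := by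
  have hc : Tendsto (fun n : ℕ => (n : ℝ)) atTop atTop := tendsto_natCast_atTop_atTop
  have hj' : Tendsto (fun n => (j n : ℝ)) atTop atTop := by
    refine (hj.pos_mul_atTop h0 hc).congr' ?_
    filter_upwards [hc.eventually_gt_atTop 0] with n hn
    field_simp
  have hjtop : Tendsto j atTop atTop := tendsto_natCast_atTop_iff.1 hj'
  refine ⟨fun n => aemeasurable_of_bucketTree _ _, aemeasurable_id, ?_⟩
  have hid : (⟨(F.negBinLimit b hb ρ h0 h1 : Measure ℝ).map id,
      Measure.isProbabilityMeasure_map aemeasurable_id⟩ : ProbabilityMeasure ℝ) =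
      F.negBinLimit b hb ρ h0 h1 := Subtype.ext Measure.map_id
  rw [hid]
  -- The negative binomial masses are nonnegative as limits of Pólya weights.
  have hnn : ∀ l ∈ Finset.Icc 1 b, ∀ m : ℕ,
      0 ≤ Ring.choose (l + F.kappa + m - 1) m * ρ ^ (l + F.kappa) * (1 - ρ) ^ m := by
    intro l hl m
    have hr := F.add_kappa_pos (Finset.mem_Icc.1 hl).1
    refine ge_of_tendsto (tendsto_polyaWeight_negBin hr l h0 h1 hj m) ?_
    filter_upwards [hjtop.eventually_gt_atTop b] with n hn
    exact F.polyaWeight_kappa_nonneg hl hn _ _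
  refine tendsto_probabilityMeasure_of_le_liminf_density (ν := (Measure.count : Measure ℕ))
    (h := fun _ m => ((m + 1 : ℕ) : ℝ) - 1) (H := fun m => (m : ℝ))
    (g := fun n m => ENNReal.ofReal (F.descendantsWeight b n (j n) m))
    (G := fun m => ENNReal.ofReal (∑ l ∈ Finset.Icc 1 b, F.limitSizeWeight b l *
      (Ring.choose (l + F.kappa + m - 1) m * ρ ^ (l + F.kappa) * (1 - ρ) ^ m)))
    (fun _ => Measurable.of_discrete) (fun _ => Measurable.of_discrete) ?_ ?_ ?_ ?_
  · filter_upwards [hjtop.eventually_gt_atTop b, hj.eventually_lt_const h1,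
      hc.eventually_gt_atTop 0] with n h2 h3 h4 U hU
    rw [div_lt_one h4] at h3
    rw [lintegral_count]
    exact F.map_descendants_apply hb h2 (by exact_mod_cast h3.le) (fun k => (k : ℝ) - 1)
      hU.measurableSet
  · intro U hU
    change (F.limitSizeLaw b).bind _ U = _
    rw [bind_apply_eq_sum (F.ae_limitSizeLaw b) _ hU.measurableSet]
    have hstep : ∀ l ∈ Finset.Icc 1 b,
        F.limitSizeLaw b {l} * negBinMeasure (l + F.kappa) ρ U =
        ∫⁻ m : ℕ, U.indicator 1 (m : ℝ) * ENNReal.ofReal (F.limitSizeWeight b l *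
          (Ring.choose (l + F.kappa + m - 1) m * ρ ^ (l + F.kappa) * (1 - ρ) ^ m))
            ∂Measure.count := by
      intro l hl
      rw [F.limitSizeLaw_singleton hl, negBinMeasure, Measure.sum_apply _ hU.measurableSet,
        lintegral_count, ← ENNReal.tsum_mul_left]
      refine tsum_congr fun m => ?_
      rw [Measure.smul_apply, Measure.dirac_apply' _ hU.measurableSet, smul_eq_mul,
        ENNReal.ofReal_mul (F.limitSizeWeight_nonneg b (Finset.mem_Icc.1 hl).1)]
      ring
    rw [Finset.sum_congr rfl hstep, ← lintegral_finsetSum _ fun _ _ => Measurable.of_discrete]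
    refine lintegral_congr fun m => ?_
    rw [← Finset.mul_sum, ENNReal.ofReal_sum_of_nonneg fun l hl => mul_nonneg
      (F.limitSizeWeight_nonneg b (Finset.mem_Icc.1 hl).1) (hnn l hl m)]
  · refine Eventually.of_forall fun m => ?_
    simp
  · refine Eventually.of_forall fun m => ?_
    refine ofReal_le_liminf (tendsto_finsetSum _ fun l hl => ?_)
      (Eventually.of_forall fun _ => le_rfl)
    have hl' := Finset.mem_Icc.1 hl
    exact ((F.tendsto_initialSizeProb hl'.1 hl'.2).comp hjtop).mul
      (tendsto_polyaWeight_negBin (F.add_kappa_pos hl'.1) l h0 h1 hj m)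

/-! ### The regime n − j = o(n) -/

/-- The product is the probability of no success in N draws. As long as none has occurred, a draw
succeeds with probability r/(r+s+i) ≤ r/(r+s), so a union bound applies. -/
lemma one_sub_le_prod_div {r s : ℝ} (hr : 0 < r) (hs : 0 < s) (N : ℕ) :
    1 - N * (r / (r + s)) ≤ ∏ i ∈ Finset.range N, (s + i) / (r + s + i) ∧
      ∏ i ∈ Finset.range N, (s + i) / (r + s + i) ≤ 1 := by
  induction N with
  | zero => simp
  | succ N ih =>
    rw [Finset.prod_range_succ]
    set P := ∏ i ∈ Finset.range N, (s + i) / (r + s + i)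
    have hP : 0 ≤ P := Finset.prod_nonneg fun i _ => by positivity
    have h1 : (s + N) / (r + s + N) = 1 - r / (r + s + N) := by field_simp; ring
    have h2 : r / (r + s + N) ≤ r / (r + s) :=
      div_le_div_of_nonneg_left hr.le (by positivity) (by linarith [show (0 : ℝ) ≤ N by positivity])
    have h3 : 0 ≤ r / (r + s + N) := by positivity
    rw [h1]
    push_cast
    constructor <;> nlinarith [ih.1, ih.2]

lemma abs_treeLaw_descendants_eq_one_sub_one_le (F : BucketFamily) {b j n : ℕ} (hb : 1 ≤ b)
    (hj : b < j) (hn : j ≤ n) :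
    |(F.treeLaw b n).real {T | T.descendants j = 1} - 1| ≤
      ((n : ℝ) - j) * ((b + F.kappa) / (j + F.kappa)) := by
  have hbj : ∀ l ∈ Finset.Icc 1 b, |polyaWeight (l + F.kappa) (j - l) (n - j) 0 - 1| ≤
      ((n : ℝ) - j) * ((b + F.kappa) / (j + F.kappa)) := by
    intro l hl
    have hl' := Finset.mem_Icc.1 hl
    have hs : (0 : ℝ) < j - l := by
      have : (l : ℝ) < j := by exact_mod_cast (by omega : l < j)
      linarith
    have hlb : (l : ℝ) ≤ b := by exact_mod_cast hl'.2
    have hjk := F.add_kappa_pos (m := j) (by omega)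
    obtain ⟨h1, h2⟩ := one_sub_le_prod_div (F.add_kappa_pos hl'.1) hs (n - j)
    have h3 : (l + F.kappa) / (l + F.kappa + (j - l)) ≤ (b + F.kappa) / (j + F.kappa) := by
      rw [show l + F.kappa + (j - l) = j + F.kappa by ring]
      exact div_le_div_of_nonneg_right (by linarith) hjk.le
    have h4 : (0 : ℝ) ≤ n - j := by
      have : (j : ℝ) ≤ n := by exact_mod_cast hn
      linarith
    rw [Nat.cast_sub hn] at h1
    have h5 := mul_le_mul_of_nonneg_left h3 h4
    simp only [polyaWeight, Finset.range_zero, Finset.prod_empty, one_mul, mul_one]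
    rw [abs_of_nonpos (by linarith)]
    linarith
  have hlaw : (F.treeLaw b n).real {T | T.descendants j = 1} - 1 =
      ∑ l ∈ Finset.Icc 1 b, F.initialSizeProb b j l *
        (polyaWeight (l + F.kappa) (j - l) (n - j) 0 - 1) := by
    have h := F.treeLaw_descendants hb hj hn 0
    rw [zero_add] at h
    simp only [mul_sub, mul_one]
    rw [Finset.sum_sub_distrib, F.sum_initialSizeProb hb (by omega), Measure.real, h,
      ENNReal.toReal_ofReal]
    · rfl
    · exact Finset.sum_nonneg fun l hl => mul_nonneg (F.initialSizeProb_nonneg b j l)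
        (F.polyaWeight_kappa_nonneg hl hj _ _)
  rw [hlaw]
  calc _ ≤ ∑ l ∈ Finset.Icc 1 b, F.initialSizeProb b j l *
        (((n : ℝ) - j) * ((b + F.kappa) / (j + F.kappa))) := by
        refine (Finset.abs_sum_le_sum_abs _ _).trans (Finset.sum_le_sum fun l hl => ?_)
        rw [abs_mul, abs_of_nonneg (F.initialSizeProb_nonneg b j l)]
        exact mul_le_mul_of_nonneg_left (hbj l hl) (F.initialSizeProb_nonneg b j l)
    _ = _ := by rw [← Finset.sum_mul, F.sum_initialSizeProb hb (by omega), one_mul]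

lemma treeLaw_descendants_eq_one_isBigO (F : BucketFamily) {b : ℕ} (hb : 1 ≤ b) {j : ℕ → ℕ}
    (hj : Tendsto j atTop atTop) (hjn : ∀ᶠ n in atTop, j n ≤ n)
    (ho : (fun n : ℕ => (n : ℝ) - j n) =o[atTop] (fun n : ℕ => (n : ℝ))) :
    (fun n : ℕ => (F.treeLaw b n).real {T | T.descendants (j n) = 1} - 1)
      =O[atTop] (fun n : ℕ => ((n : ℝ) - j n) / n) := by
  -- The factor 2 comes from j + κ ≥ n/2, which holds once n − j ≤ n/4 and n ≥ 4, because κ > −1.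
  refine IsBigO.of_bound (2 * (b + F.kappa)) ?_
  filter_upwards [hjn, hj.eventually_gt_atTop b, ho.def (show (0 : ℝ) < 1 / 4 by norm_num),
    eventually_ge_atTop 4] with n h1 h2 h3 h4
  have h4' : (4 : ℝ) ≤ n := by exact_mod_cast h4
  have h1' : (0 : ℝ) ≤ n - j n := by
    have : (j n : ℝ) ≤ n := by exact_mod_cast h1
    linarith
  have hκ := F.neg_one_lt_kappa
  have hbκ := F.add_kappa_pos hb
  rw [Real.norm_of_nonneg h1', Real.norm_of_nonneg (by positivity)] at h3
  rw [Real.norm_eq_abs, Real.norm_of_nonneg (by positivity)]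
  refine (F.abs_treeLaw_descendants_eq_one_sub_one_le hb h2 h1).trans ?_
  have h5 : (b + F.kappa) / (j n + F.kappa) ≤ 2 * (b + F.kappa) / n := by
    rw [div_le_div_iff₀ (by linarith) (by linarith)]
    nlinarith
  calc _ ≤ _ := mul_le_mul_of_nonneg_left h5 h1'
    _ = _ := by ring

end BucketFamily

theorem mainTheorem6 (F : BucketFamily) (b : ℕ) (hb : 1 ≤ b) :
    -- the initial bucket sizes `K_n` converge in distribution to `K`
    TendstoInDistribution (fun n (T : BucketTree) => T.cap (T.node n)) atTop id
      (fun n => F.treeLaw b n) (F.limitSize b hb : Measure ℕ) ∧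
    -- (1) `j ≥ b + 1` fixed
    (∀ (j : ℕ) (hj : b + 1 ≤ j),
      TendstoInDistribution (fun (n : ℕ) (T : BucketTree) => (T.descendants j : ℝ) / n) atTop id
        (fun n => F.treeLaw b n) (F.betaLimit b j hb hj : Measure ℝ)) ∧
    -- (2) `j → ∞`, `j = o(n)`
    (∀ j : ℕ → ℕ, Tendsto j atTop atTop →
      (fun n => (j n : ℝ)) =o[atTop] (fun n : ℕ => (n : ℝ)) →
      TendstoInDistribution
        (fun (n : ℕ) (T : BucketTree) => (j n : ℝ) * (T.descendants (j n) : ℝ) / n) atTop id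
        (fun n => F.treeLaw b n) (F.gammaLimit b hb : Measure ℝ)) ∧
    -- (3) `j ∼ ρ n` with `0 < ρ < 1`
    (∀ (j : ℕ → ℕ) (ρ : ℝ) (h0 : 0 < ρ) (h1 : ρ < 1),
      Tendsto (fun n : ℕ => (j n : ℝ) / n) atTop (𝓝 ρ) →
      TendstoInDistribution
        (fun (n : ℕ) (T : BucketTree) => (T.descendants (j n) : ℝ) - 1) atTop id
        (fun n => F.treeLaw b n) (F.negBinLimit b hb ρ h0 h1 : Measure ℝ)) ∧
    -- (4) `j → ∞`, `j ≤ n`, `n - j = o(n)`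
    (∀ j : ℕ → ℕ, Tendsto j atTop atTop → (∀ᶠ n in atTop, j n ≤ n) →
      (fun n : ℕ => (n : ℝ) - j n) =o[atTop] (fun n : ℕ => (n : ℝ)) →
      (fun n : ℕ => (F.treeLaw b n).real {T | T.descendants (j n) = 1} - 1)
          =O[atTop] (fun n : ℕ => ((n : ℝ) - j n) / n) ∧
        Tendsto (fun n : ℕ => (F.treeLaw b n).real {T | T.descendants (j n) = 1}) atTop (𝓝 1)) := by
  refine ⟨F.tendstoInDistribution_initialSize hb, F.tendstoInDistribution_beta hb,
    fun j hj hjn => F.tendstoInDistribution_gamma hb hj hjn,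
    fun j ρ h0 h1 hj => F.tendstoInDistribution_negBin hb h0 h1 hj, fun j hj hjn ho => ?_⟩
  have hO := F.treeLaw_descendants_eq_one_isBigO hb hj hjn ho
  refine ⟨hO, ?_⟩
  have := (hO.trans_tendsto ho.tendsto_div_nhds_zero).add_const 1
  simpa using this
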